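/- Let $G_1$ and $G_2$ be locally compact (Hausdorff) groups such that for $i=1,2$ and every $x\in G_i$ the conjugacy class $\{gxg^{-1}: g\in G_i\}$ has compact closure ($[FC]^-$ groups). For $i=1,2$ let $\omega_i:G_i\to(0,\infty)$ be a weight, that is, a Borel measurable function with $\omega_i(xy)\le\omega_i(x)\,\omega_i(y)$ for all $x,y\in G_i$, and suppose that there is a constant $c>0$ such that $\omega_i(gxg^{-1})\le c\,\omega_i(x)$ for all $x,g\in G_i$ ($i=1,2$). Then, as Banach algebras, $$ZL^1(G_1\times G_2,\omega_1\times\omega_2)\simeq ZL^1(G_1,\omega_1)\,\widehat{\otimes}\,ZL^1(G_2,\omega_2),$$ that is, there is a bijective linear map between the two sides that is multiplicative and a homeomorphism. Here $(\omega_1\times\omega_2)(x,y)=\omega_1(x)\,\omega_2(y)$. For a weight $\omega$ on a locally compact group $G$ with a fixed left Haar measure $dx$, $L^1(G,\omega)$ is the Banach algebra of (classes modulo null sets of) measurable functions $f:G\to\mathbb{C}$ with $\|f\|_\omega=\int_G|f(x)|\,\omega(x)\,dx<\infty$, with the convolution product $(f*h)(x)=\int_G f(y)\,h(y^{-1}x)\,dy$,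 and $ZL^1(G,\omega)$ is its closed subalgebra of all $f$ such that for every $g\in G$ one has $f(g^{-1}xg)=f(x)$ for almost every $x\in G$. The symbol $\widehat{\otimes}$ denotes the projective tensor product of Banach algebras, with the product determined by $(a\otimes b)(a'\otimes b')=aa'\otimes bb'$. -/

import Mathlib

noncomputable section

namespace Beurling

open MeasureTheory Filter Topology Set
open scoped ENNReal NNReal TensorProduct Pointwise

section Projective

/-- The cost `∑ ‖aᵢ‖ ‖bᵢ‖` of the formal sum `∑ aᵢ ⊗ bᵢ` given by a list of pairs. -/
def pureCost {A B : Type*} [NormedAddCommGroup A] [NormedAddCommGroup B]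
    (l : List (A × B)) : ℝ := (l.map fun p => ‖p.1‖ * ‖p.2‖).sum

theorem pureCost_nonneg {A B : Type*} [NormedAddCommGroup A] [NormedAddCommGroup B]
    (l : List (A × B)) : 0 ≤ pureCost l := by
  refine List.sum_nonneg fun a ha => ?_
  obtain ⟨p, _, rfl⟩ := List.mem_map.1 ha
  positivity
theorem pureCost_append {A B : Type*} [NormedAddCommGroup A] [NormedAddCommGroup B]
    (l l' : List (A × B)) : pureCost (l ++ l') = pureCost l + pureCost l' := by
  simp [pureCost]


variable (A B : Type*) [NormedAddCommGroup A] [NormedSpace ℂ A]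
  [NormedAddCommGroup B] [NormedSpace ℂ B]

/-- The algebraic tensor product of two complex normed spaces, as a type of its own that carries the
projective norm. -/
def AlgTensor : Type _ := A ⊗[ℂ] B

instance : AddCommGroup (AlgTensor A B) := inferInstanceAs (AddCommGroup (A ⊗[ℂ] B))
instance : Module ℂ (AlgTensor A B) := inferInstanceAs (Module ℂ (A ⊗[ℂ] B))
variable {A B}

/-- The tensor `∑ aᵢ ⊗ bᵢ` given by a list of pairs `(aᵢ, bᵢ)`. -/
def pureSum (l : List (A × B)) : AlgTensor A B := (l.map fun p => (p.1 ⊗ₜ[ℂ] p.2 : A ⊗[ℂ] B)).sum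

/-- The projective norm: the infimum of `∑ ‖aᵢ‖ ‖bᵢ‖` over all finite representations
`t = ∑ aᵢ ⊗ bᵢ`. -/
instance : Norm (AlgTensor A B) := ⟨fun t => sInf {r | ∃ l : List (A × B), pureSum l = t ∧ pureCost l = r}⟩

theorem norm_def (t : AlgTensor A B) :
    ‖t‖ = sInf {r | ∃ l : List (A × B), pureSum l = t ∧ pureCost l = r} := rfl

theorem pureSum_nil : pureSum ([] : List (A × B)) = 0 := rfl
theorem pureSum_cons (p : A × B) (l : List (A × B)) :
    pureSum (p :: l) = pureSum [p] + pureSum l := by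
  simp [pureSum]; rfl
theorem pureSum_append (l l' : List (A × B)) : pureSum (l ++ l') = pureSum l + pureSum l' := by
  simp [pureSum]; rfl
theorem norm_le_pureCost (l : List (A × B)) : ‖pureSum l‖ ≤ pureCost l :=
  csInf_le ⟨0, by rintro _ ⟨l, -, rfl⟩; exact pureCost_nonneg l⟩ ⟨l, rfl, rfl⟩

theorem exists_pureSum (t : AlgTensor A B) : ∃ l : List (A × B), pureSum l = t := by
  refine TensorProduct.induction_on (motive := fun t : A ⊗[ℂ] B => ∃ l : List (A × B), pureSum l = t)
    t ⟨[], rfl⟩ (fun a b => ⟨[(a, b)], add_zero _⟩) ?_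
  rintro _ _ ⟨l, rfl⟩ ⟨l', rfl⟩
  exact ⟨l ++ l', pureSum_append l l'⟩

theorem le_norm {t : AlgTensor A B} {c : ℝ} (h : ∀ l, pureSum l = t → c ≤ pureCost l) : c ≤ ‖t‖ := by
  obtain ⟨l, hl⟩ := exists_pureSum t
  refine le_csInf ⟨_, l, hl, rfl⟩ ?_
  rintro _ ⟨l, hl, rfl⟩
  exact h l hl

theorem norm_nonneg' (t : AlgTensor A B) : 0 ≤ ‖t‖ := le_norm fun l _ => pureCost_nonneg l

theorem norm_zero' : ‖(0 : AlgTensor A B)‖ = 0 :=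
  le_antisymm (by simpa [pureCost, pureSum_nil] using norm_le_pureCost ([] : List (A × B))) (norm_nonneg' _)

theorem norm_add_le' (s t : AlgTensor A B) : ‖s + t‖ ≤ ‖s‖ + ‖t‖ := by
  rw [← sub_le_iff_le_add]
  refine le_norm fun l hl => ?_
  rw [sub_le_iff_le_add, ← sub_le_iff_le_add']
  refine le_norm fun l' hl' => ?_
  rw [sub_le_iff_le_add', ← pureCost_append, ← hl, ← hl', ← pureSum_append]
  exact norm_le_pureCost _

theorem norm_smul_le' (c : ℂ) (t : AlgTensor A B) : ‖c • t‖ ≤ ‖c‖ * ‖t‖ := by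
  rcases eq_or_ne c 0 with rfl | hc
  · simp [norm_zero']
  rw [← div_le_iff₀' (norm_pos_iff.2 hc)]
  refine le_norm fun l hl => ?_
  rw [div_le_iff₀' (norm_pos_iff.2 hc)]
  have h1 : pureSum (l.map fun p => (c • p.1, p.2)) = c • t := by
    subst hl
    have : ∀ l : List (A × B), pureSum (l.map fun p => (c • p.1, p.2)) = c • pureSum l := by
      intro l
      induction l with
      | nil => simp [pureSum_nil]
      | cons p l ih =>
        rw [List.map_cons, pureSum_cons, pureSum_cons p, ih, smul_add]
        congr 1
    exact this l
  have h2 : pureCost (l.map fun p => (c • p.1, p.2)) = ‖c‖ * pureCost l := by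
    simp [pureCost, Function.comp_def, norm_smul, mul_assoc, List.sum_map_mul_left]
  rw [← h1, ← h2]
  exact norm_le_pureCost _

variable (A B)

instance : SeminormedAddCommGroup (AlgTensor A B) :=
  AddGroupSeminorm.toSeminormedAddCommGroup
    { toFun := fun t => ‖t‖
      map_zero' := norm_zero'
      add_le' := norm_add_le'
      neg' := fun t => by
        have h : ∀ t : AlgTensor A B, ‖-t‖ ≤ ‖t‖ := fun t => by
          simpa using norm_smul_le' (-1 : ℂ) t
        exact le_antisymm (h t) (by simpa using h (-t)) }

instance : NormedSpace ℂ (AlgTensor A B) := ⟨norm_smul_le'⟩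

/-- The projective tensor product `A ⊗̂ B`: the completion of the algebraic tensor product for the
projective norm. -/
def ProjTensor : Type _ := UniformSpace.Completion (AlgTensor A B)

instance : NormedAddCommGroup (ProjTensor A B) :=
  inferInstanceAs (NormedAddCommGroup (UniformSpace.Completion (AlgTensor A B)))
instance : NormedSpace ℂ (ProjTensor A B) :=
  inferInstanceAs (NormedSpace ℂ (UniformSpace.Completion (AlgTensor A B)))
instance : CompleteSpace (ProjTensor A B) :=
  inferInstanceAs (CompleteSpace (UniformSpace.Completion (AlgTensor A B)))

/-- The canonical map from the algebraic into the projective tensor product. -/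
def ProjTensor.of : AlgTensor A B →L[ℂ] ProjTensor A B :=
  UniformSpace.Completion.toComplL

variable {A B}

/-- The elementary tensor `a ⊗ b` as an element of `A ⊗̂ B`. -/
def ProjTensor.tmul (a : A) (b : B) : ProjTensor A B := ProjTensor.of A B (pureSum [(a, b)])

theorem ProjTensor.norm_of (t : AlgTensor A B) : ‖ProjTensor.of A B t‖ = ‖t‖ :=
  UniformSpace.Completion.norm_coe t

theorem ProjTensor.isDenseInducing_of : IsDenseInducing (ProjTensor.of A B) :=
  UniformSpace.Completion.isDenseInducing_coe

theorem ProjTensor.induction₁ {p : ProjTensor A B → Prop} (hp : IsClosed {x | p x})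
    (h : ∀ a, p (ProjTensor.of A B a)) (x) : p x :=
  UniformSpace.Completion.induction_on x hp h

theorem ProjTensor.induction₂ {p : ProjTensor A B → ProjTensor A B → Prop}
    (hp : IsClosed {x : ProjTensor A B × ProjTensor A B | p x.1 x.2})
    (h : ∀ a b, p (ProjTensor.of A B a) (ProjTensor.of A B b)) (x y) : p x y :=
  UniformSpace.Completion.induction_on₂ x y hp h

theorem ProjTensor.induction₃ {p : ProjTensor A B → ProjTensor A B → ProjTensor A B → Prop}
    (hp : IsClosed {x : ProjTensor A B × ProjTensor A B × ProjTensor A B | p x.1 x.2.1 x.2.2})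
    (h : ∀ a b c, p (ProjTensor.of A B a) (ProjTensor.of A B b) (ProjTensor.of A B c))
    (x y z) : p x y z :=
  UniformSpace.Completion.induction_on₃ x y z hp h

end Projective

section ProjectiveAlgebra

variable {A B : Type*} [NonUnitalNormedRing A] [NormedSpace ℂ A] [IsScalarTower ℂ A A]
  [SMulCommClass ℂ A A] [NonUnitalNormedRing B] [NormedSpace ℂ B] [IsScalarTower ℂ B B]
  [SMulCommClass ℂ B B]

/-- The usual algebra structure: `(a ⊗ b) * (a' ⊗ b') = (a * a') ⊗ (b * b')`. -/
instance : NonUnitalRing (AlgTensor A B) := inferInstanceAs (NonUnitalRing (A ⊗[ℂ] B))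
instance : IsScalarTower ℂ (AlgTensor A B) (AlgTensor A B) :=
  inferInstanceAs (IsScalarTower ℂ (A ⊗[ℂ] B) (A ⊗[ℂ] B))
instance : SMulCommClass ℂ (AlgTensor A B) (AlgTensor A B) :=
  inferInstanceAs (SMulCommClass ℂ (A ⊗[ℂ] B) (A ⊗[ℂ] B))

theorem norm_mul_le' (s t : AlgTensor A B) : ‖s * t‖ ≤ ‖s‖ * ‖t‖ := by
  have key : ∀ (p : A × B), ‖pureSum [p] * t‖ ≤ (‖p.1‖ * ‖p.2‖) * ‖t‖ := by
    intro p
    have h1 : ∀ l : List (A × B),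
        pureSum (l.map fun q => (p.1 * q.1, p.2 * q.2)) = pureSum [p] * pureSum l := by
      intro l
      induction l with
      | nil => simp [pureSum_nil]
      | cons q l ih =>
        rw [List.map_cons, pureSum_cons, pureSum_cons q, ih, mul_add]
        congr 1
        simp only [pureSum, List.map_cons, List.map_nil, List.sum_singleton]
        exact (Algebra.TensorProduct.tmul_mul_tmul p.1 q.1 p.2 q.2).symm
    have h2 : ∀ l : List (A × B), pureCost (l.map fun q => (p.1 * q.1, p.2 * q.2)) ≤
        (‖p.1‖ * ‖p.2‖) * pureCost l := by
      intro l
      rw [pureCost, pureCost, ← List.sum_map_mul_left, List.map_map]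
      refine List.sum_le_sum fun q _ => ?_
      calc ‖p.1 * q.1‖ * ‖p.2 * q.2‖ ≤ (‖p.1‖ * ‖q.1‖) * (‖p.2‖ * ‖q.2‖) := by
            gcongr <;> exact norm_mul_le _ _
        _ = _ := by ring
    rcases (by positivity : 0 ≤ ‖p.1‖ * ‖p.2‖).eq_or_lt with h0 | h0
    · obtain ⟨l, rfl⟩ := exists_pureSum t
      rw [← h1, ← h0, zero_mul]
      exact (norm_le_pureCost _).trans ((h2 l).trans (by simp [← h0]))
    · rw [← div_le_iff₀' h0]
      refine le_norm fun l hl => ?_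
      rw [div_le_iff₀' h0, ← hl, ← h1]
      exact (norm_le_pureCost _).trans (h2 l)
  have key2 : ∀ l : List (A × B), ‖pureSum l * t‖ ≤ pureCost l * ‖t‖ := by
    intro l
    induction l with
    | nil => simp [pureSum_nil, pureCost]
    | cons p l ih =>
      rw [pureSum_cons, add_mul]
      refine (norm_add_le' _ _).trans ((add_le_add (key p) ih).trans_eq ?_)
      simp [pureCost]; ring
  rcases (norm_nonneg' t).eq_or_lt with h0 | h0
  · obtain ⟨l, rfl⟩ := exists_pureSum s
    simpa [← h0] using key2 l
  · rw [← div_le_iff₀ h0]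
    refine le_norm fun l hl => ?_
    rw [div_le_iff₀ h0, ← hl]
    exact key2 l

instance : NonUnitalSeminormedRing (AlgTensor A B) :=
  { (inferInstance : SeminormedAddCommGroup (AlgTensor A B)),
    (inferInstance : NonUnitalRing (AlgTensor A B)) with
    norm_mul_le := norm_mul_le' }

/-- The product of `A ⊗̂ B`, for normed algebras `A` and `B`: the continuous extension of the product
`(a ⊗ b) * (a' ⊗ b') = (a * a') ⊗ (b * b')` of the algebraic tensor product. -/
instance : Mul (ProjTensor A B) :=
  ⟨fun s t => (ProjTensor.isDenseInducing_of.prodMap ProjTensor.isDenseInducing_of).extend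
    (fun p : AlgTensor A B × AlgTensor A B => ProjTensor.of A B (p.1 * p.2)) (s, t)⟩

theorem ProjTensor.of_mul (s t : AlgTensor A B) :
    ProjTensor.of A B (s * t) = ProjTensor.of A B s * ProjTensor.of A B t :=
  ((ProjTensor.isDenseInducing_of.prodMap ProjTensor.isDenseInducing_of).extend_eq
    ((ProjTensor.of A B).continuous.comp continuous_mul) (s, t)).symm

instance : ContinuousMul (ProjTensor A B) where
  continuous_mul := by
    let m := (AddMonoidHom.mul : AlgTensor A B →+ AlgTensor A B →+ AlgTensor A B).compr₂
      (ProjTensor.of A B).toLinearMap.toAddMonoidHom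
    have hm : Continuous fun p : AlgTensor A B × AlgTensor A B => m p.1 p.2 :=
      (ProjTensor.of A B).continuous.comp continuous_mul
    have di : IsDenseInducing (ProjTensor.of A B).toLinearMap.toAddMonoidHom :=
      ProjTensor.isDenseInducing_of
    exact di.extend_Z_bilin di hm

instance : NonUnitalNormedRing (ProjTensor A B) :=
  { (inferInstance : NormedAddCommGroup (ProjTensor A B)),
    (inferInstance : Mul (ProjTensor A B)) with
    left_distrib := ProjTensor.induction₃ (isClosed_eq (by fun_prop) (by fun_prop))
      fun a b c => by simp only [← map_add, ← ProjTensor.of_mul, mul_add]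
    right_distrib := ProjTensor.induction₃ (isClosed_eq (by fun_prop) (by fun_prop))
      fun a b c => by simp only [← map_add, ← ProjTensor.of_mul, add_mul]
    zero_mul := ProjTensor.induction₁ (isClosed_eq (by fun_prop) (by fun_prop))
      fun a => by rw [← map_zero (ProjTensor.of A B), ← ProjTensor.of_mul, zero_mul]
    mul_zero := ProjTensor.induction₁ (isClosed_eq (by fun_prop) (by fun_prop))
      fun a => by rw [← map_zero (ProjTensor.of A B), ← ProjTensor.of_mul, mul_zero]
    mul_assoc := ProjTensor.induction₃ (isClosed_eq (by fun_prop) (by fun_prop))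
      fun a b c => by simp only [← ProjTensor.of_mul, mul_assoc]
    norm_mul_le := ProjTensor.induction₂ (isClosed_le (by fun_prop) (by fun_prop))
      fun a b => by
        rw [← ProjTensor.of_mul, ProjTensor.norm_of, ProjTensor.norm_of, ProjTensor.norm_of]
        exact norm_mul_le a b }

instance : IsScalarTower ℂ (ProjTensor A B) (ProjTensor A B) where
  smul_assoc c x y := by
    rw [smul_eq_mul, smul_eq_mul]
    revert x y
    refine ProjTensor.induction₂ (p := fun x y => (c • x) * y = c • (x * y))
      (isClosed_eq ((continuous_fst.const_smul c).mul continuous_snd)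
        ((continuous_fst.mul continuous_snd).const_smul c)) fun a b => ?_
    simp only [← map_smul, ← ProjTensor.of_mul, smul_mul_assoc]

instance : SMulCommClass ℂ (ProjTensor A B) (ProjTensor A B) where
  smul_comm c x y := by
    rw [smul_eq_mul, smul_eq_mul]
    revert x y
    refine ProjTensor.induction₂ (p := fun x y => c • (x * y) = x * (c • y))
      (isClosed_eq ((continuous_fst.mul continuous_snd).const_smul c)
        (continuous_fst.mul (continuous_snd.const_smul c))) fun a b => ?_
    simp only [← map_smul, ← ProjTensor.of_mul, mul_smul_comm]

theorem ProjTensor.tmul_mul_tmul (a a' : A) (b b' : B) :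
    ProjTensor.tmul a b * ProjTensor.tmul a' b' = ProjTensor.tmul (a * a') (b * b') :=
  (ProjTensor.of_mul (A := A) (B := B) (pureSum [(a, b)]) (pureSum [(a', b')])).symm.trans (by
    simp only [ProjTensor.tmul, pureSum, List.map_cons, List.map_nil, List.sum_singleton]
    exact congrArg (ProjTensor.of A B) (Algebra.TensorProduct.tmul_mul_tmul a a' b b'))

end ProjectiveAlgebra
/-- `[FC]⁻` groups: every conjugacy class has compact closure. -/
class IsFCBar (G : Type*) [Group G] [TopologicalSpace G] : Prop where
  isCompact_closure_conj : ∀ x : G, IsCompact (closure (range fun g : G => g * x * g⁻¹))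

instance {G H : Type*} [Group G] [TopologicalSpace G] [Group H] [TopologicalSpace H]
    [IsFCBar G] [IsFCBar H] : IsFCBar (G × H) where
  isCompact_closure_conj x := by
    refine ((IsFCBar.isCompact_closure_conj x.1).prod
      (IsFCBar.isCompact_closure_conj x.2)).of_isClosed_subset isClosed_closure ?_
    rw [← closure_prod_eq]
    refine closure_mono ?_
    rintro _ ⟨g, rfl⟩
    exact ⟨⟨g.1, rfl⟩, ⟨g.2, rfl⟩⟩

/-- A weight on a topological group: a Borel measurable, strictly positive, submultiplicative
function. -/
structure Weight (G : Type*) [Group G] [TopologicalSpace G] where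
  toFun : G → ℝ
  measurable' : @Measurable G ℝ (borel G) _ toFun
  pos' : ∀ x, 0 < toFun x
  mul_le' : ∀ x y, toFun (x * y) ≤ toFun x * toFun y

namespace Weight

instance {G : Type*} [Group G] [TopologicalSpace G] : CoeFun (Weight G) fun _ => G → ℝ := ⟨toFun⟩

/-- The weight `(x, y) ↦ ω₁ x * ω₂ y` on the product group. -/
def prod {G H : Type*} [Group G] [TopologicalSpace G] [Group H] [TopologicalSpace H]
    (ω₁ : Weight G) (ω₂ : Weight H) : Weight (G × H) where
  toFun x := ω₁ x.1 * ω₂ x.2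
  measurable' := by
    let := borel G
    let := borel H
    let := borel (G × H)
    have : BorelSpace G := ⟨rfl⟩
    have : BorelSpace H := ⟨rfl⟩
    have : BorelSpace (G × H) := ⟨rfl⟩
    exact (ω₁.measurable'.comp continuous_fst.borel_measurable).mul
      (ω₂.measurable'.comp continuous_snd.borel_measurable)
  pos' x := mul_pos (ω₁.pos' _) (ω₂.pos' _)
  mul_le' x y := by
    calc ω₁ (x.1 * y.1) * ω₂ (x.2 * y.2) ≤ (ω₁ x.1 * ω₁ y.1) * (ω₂ x.2 * ω₂ y.2) :=
          mul_le_mul (ω₁.mul_le' _ _) (ω₂.mul_le' _ _) (ω₂.pos' _).le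
            (mul_nonneg (ω₁.pos' _).le (ω₁.pos' _).le)
      _ = _ := by ring

end Weight

/-- Every topological space is given its Borel σ-algebra. This is used as a local instance for groups,
so that a product of two groups gets the Borel σ-algebra of the product topology (which may be larger
than the product of the two σ-algebras). -/
@[reducible] def borelMeasurableSpace (G : Type*) [TopologicalSpace G] : MeasurableSpace G := borel G
theorem borelSpace (G : Type*) [TopologicalSpace G] :
  @BorelSpace G _ (borelMeasurableSpace G) := @BorelSpace.mk G _ (borelMeasurableSpace G) rfl

attribute [local instance 10] borelMeasurableSpace borelSpace

theorem Weight.measurable {G : Type*} [Group G] [TopologicalSpace G] (ω : Weight G) :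
    Measurable ω := ω.measurable'

theorem Weight.measurable_ofReal {G : Type*} [Group G] [TopologicalSpace G] (ω : Weight G) :
    Measurable fun x => ENNReal.ofReal (ω x) := ω.measurable.ennreal_ofReal

variable {G : Type*} [Group G] [TopologicalSpace G] [IsTopologicalGroup G]
  [LocallyCompactSpace G]

/-- On a locally compact group all of whose conjugacy classes are precompact, a left Haar measure
is also right invariant. -/
theorem map_mul_right_haar [IsFCBar G] (g : G) :
    Measure.map (· * g) (Measure.haar : Measure G) = Measure.haar := by
  set μ : Measure G := Measure.haar with hμ
  obtain ⟨c, hc⟩ : ∃ c : ℝ≥0, Measure.map (· * g) μ = c • μ := by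
    have : (Measure.map (· * g) μ).Regular := Measure.Regular.map (Homeomorph.mulRight g)
    exact ⟨_, Measure.isMulLeftInvariant_eq_smul_of_regular _ μ⟩
  have hpre : ∀ s : Set G, μ ((· * g) ⁻¹' s) = c * μ s := by
    intro s
    have := (Homeomorph.mulRight g).toMeasurableEquiv.map_apply (μ := μ) s
    have h2 : (Homeomorph.mulRight g).toMeasurableEquiv ⁻¹' s = (· * g) ⁻¹' s := rfl
    rw [h2] at this
    rw [← this]
    have h3 : Measure.map (⇑(Homeomorph.mulRight g).toMeasurableEquiv) μ = c • μ := hc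
    rw [h3]; rfl
  obtain ⟨U, hU, hU1⟩ := exists_compact_mem_nhds (1 : G)
  set W : Set G := (U ∪ {g}) ∪ (U ∪ {g})⁻¹ with hW
  have hWc : IsCompact W := (hU.union isCompact_singleton).union (hU.union isCompact_singleton).inv
  have hW1 : W ∈ 𝓝 (1 : G) := mem_of_superset hU1 (fun x hx => Or.inl (Or.inl hx))
  have hgW : g ∈ W := Or.inl (Or.inr rfl)
  have hWinv : W⁻¹ = W := by rw [hW, union_inv, inv_inv, union_comm]
  have h1W : (1 : G) ∈ W := mem_of_mem_nhds hW1
  have hmono : Monotone fun n : ℕ => W ^ n := pow_right_monotone (by simpa using h1W)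
  have hcomp : ∀ n : ℕ, IsCompact (W ^ n) := fun n => by
    induction n with
    | zero => simp
    | succ n ih => rw [pow_succ]; exact ih.mul hWc
  let H : Subgroup G :=
    { carrier := ⋃ n : ℕ, W ^ n
      one_mem' := mem_iUnion.2 ⟨0, by simp⟩
      mul_mem' := by
        intro a b ha hb
        obtain ⟨m, hm⟩ := mem_iUnion.1 ha
        obtain ⟨n, hn⟩ := mem_iUnion.1 hb
        exact mem_iUnion.2 ⟨m + n, by rw [pow_add]; exact mul_mem_mul hm hn⟩
      inv_mem' := by
        intro a ha
        obtain ⟨m, hm⟩ := mem_iUnion.1 ha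
        refine mem_iUnion.2 ⟨m, ?_⟩
        rw [← hWinv, inv_pow]
        simpa using hm }
  have hHW : ∀ n : ℕ, W ^ n ⊆ (H : Set G) := fun n => subset_iUnion (fun n : ℕ => W ^ n) n
  have hWH : W ⊆ (H : Set G) := by simpa using hHW 1
  have hHopen : IsOpen (H : Set G) := H.isOpen_of_mem_nhds (mem_of_superset hW1 hWH)
  have hHclosed : IsClosed (H : Set G) := H.isClosed_of_isOpen hHopen
  have hgH : g ∈ H := hWH hgW
  let A : ℕ → Set G := fun m => {x | ∀ n : ℤ, g ^ n * x * (g ^ n)⁻¹ ∈ W ^ m}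
  have hAU : (H : Set G) ⊆ ⋃ m, A m := by
    intro x hx
    have hC : IsCompact (closure (range fun h : G => h * x * h⁻¹) ∩ H) :=
      (IsFCBar.isCompact_closure_conj x).inter_right hHclosed
    obtain ⟨m, hm⟩ := hC.elim_directed_cover (fun n : ℕ => interior (W ^ n))
      (fun n => isOpen_interior) (by
        rintro y ⟨-, hy⟩
        obtain ⟨n, hn⟩ := mem_iUnion.1 hy
        refine mem_iUnion.2 ⟨n + 1, ?_⟩
        rw [mem_interior_iff_mem_nhds, pow_succ]
        have : y • W ∈ 𝓝 y := by
          simpa using smul_mem_nhds_smul y hW1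
        refine mem_of_superset this ?_
        rintro _ ⟨w, hw, rfl⟩
        exact mul_mem_mul hn hw)
      (monotone_nat_of_le_succ (fun n => interior_mono (hmono n.le_succ))).directed_le
    refine mem_iUnion.2 ⟨m, fun n => interior_subset (hm ⟨subset_closure ⟨g ^ n, rfl⟩, ?_⟩)⟩
    exact H.mul_mem (H.mul_mem (H.zpow_mem hgH n) hx) (H.inv_mem (H.zpow_mem hgH n))
  obtain ⟨m, hm⟩ : ∃ m, μ (A m) ≠ 0 := by
    by_contra! h
    have : μ (H : Set G) = 0 := measure_mono_null hAU (measure_iUnion_null h)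
    exact (hHopen.measure_pos μ ⟨1, H.one_mem⟩).ne' this
  have hmtop : μ (A m) ≠ ∞ := by
    refine ((measure_mono ?_).trans_lt (hcomp m).measure_lt_top).ne
    intro x hx
    simpa using hx 0
  have hinv : (fun x => g⁻¹ * x) ⁻¹' ((· * g) ⁻¹' A m) = A m := by
    ext x
    constructor
    · intro hx n
      have := hx (n + 1)
      rw [zpow_add_one] at this
      convert this using 1
      group
    · intro hx n
      have := hx (n - 1)
      rw [zpow_sub_one] at this
      convert this using 1
      group
  have h4 : μ (A m) = c * μ (A m) := by
    rw [← hpre, ← measure_preimage_mul μ g⁻¹ ((· * g) ⁻¹' A m), hinv]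
  have hc1 : c = 1 := by
    have : (1 : ℝ≥0∞) * μ (A m) = c * μ (A m) := by rw [one_mul, ← h4]
    exact_mod_cast ((ENNReal.mul_left_inj hm hmtop).1 this).symm
  rw [hc, hc1, one_smul]

instance isMulRightInvariant_haar [IsFCBar G] : (Measure.haar : Measure G).IsMulRightInvariant :=
  ⟨map_mul_right_haar⟩

variable (ω : Weight G)

/-- The measure `ω(x) dx`, where `dx` is the left Haar measure. It has the same null sets as `dx`. -/
def Weight.measure : Measure G :=
  (Measure.haar : Measure G).withDensity fun x => ENNReal.ofReal (ω x)

theorem Weight.ae_measure {p : G → Prop} :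
    (∀ᵐ x ∂ω.measure, p x) ↔ ∀ᵐ x ∂(Measure.haar : Measure G), p x := by
  rw [Weight.measure, ae_withDensity_iff ω.measurable_ofReal]
  have : ∀ x, ENNReal.ofReal (ω x) ≠ 0 := fun x => by simpa using ω.pos' x
  simp [this]

theorem Weight.lintegral_measure (f : G → ℝ≥0∞) :
    ∫⁻ x, f x ∂ω.measure = ∫⁻ x, ENNReal.ofReal (ω x) * f x ∂(Measure.haar : Measure G) :=
  lintegral_withDensity_eq_lintegral_mul_non_measurable _ ω.measurable_ofReal
    (ae_of_all _ fun _ => ENNReal.ofReal_lt_top) f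

theorem Weight.aestronglyMeasurable_measure {f : G → ℂ} :
    AEStronglyMeasurable f ω.measure ↔ AEStronglyMeasurable f (Measure.haar : Measure G) := by
  refine ⟨fun h => h.mono_ac ?_, fun h => h.mono_ac (withDensity_absolutelyContinuous _ _)⟩
  exact withDensity_absolutelyContinuous' ω.measurable_ofReal.aemeasurable
    (ae_of_all _ fun x => by simpa using ω.pos' x)

/-- A weight is bounded near the identity. -/
theorem Weight.exists_nhds_one_le : ∃ C : ℝ, ∀ᶠ x in 𝓝 (1 : G), ω x ≤ C := by
  set μ : Measure G := Measure.haar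
  obtain ⟨K, hK, hK1⟩ := exists_compact_mem_nhds (1 : G)
  let E : ℕ → Set G := fun n => interior K ∩ {x | ω x ≤ n ∧ ω x⁻¹ ≤ n}
  have hE : ∀ n, MeasurableSet (E n) := fun n =>
    isOpen_interior.measurableSet.inter ((measurableSet_le ω.measurable measurable_const).inter
      (measurableSet_le (ω.measurable.comp measurable_inv) measurable_const))
  have hU : ⋃ n, E n = interior K := by
    refine Subset.antisymm (iUnion_subset fun n => inter_subset_left) fun x hx => mem_iUnion.2 ?_
    obtain ⟨n, hn⟩ := exists_nat_ge (max (ω x) (ω x⁻¹))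
    exact ⟨n, hx, (le_max_left _ _).trans hn, (le_max_right _ _).trans hn⟩
  obtain ⟨n, hn⟩ : ∃ n, μ (E n) ≠ 0 := by
    by_contra! h
    have : μ (interior K) = 0 := by rw [← hU]; exact measure_iUnion_null h
    exact (isOpen_interior.measure_pos μ ⟨1, mem_interior_iff_mem_nhds.2 hK1⟩).ne' this
  have hfin : μ (E n) ≠ ∞ :=
    ((measure_mono (inter_subset_left.trans interior_subset)).trans_lt hK.measure_lt_top).ne
  refine ⟨n * n, mem_of_superset
    (Measure.div_mem_nhds_one_of_haar_pos_ne_top μ (E n) (hE n) (pos_iff_ne_zero.2 hn) hfin) ?_⟩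
  rintro _ ⟨x, hx, y, hy, rfl⟩
  show ω (x / y) ≤ _
  rw [div_eq_mul_inv]
  exact (ω.mul_le' _ _).trans (mul_le_mul hx.2.1 hy.2.2 (ω.pos' _).le (Nat.cast_nonneg n))

/-- A weight is bounded on compact sets. -/
theorem Weight.exists_le_of_isCompact {K : Set G} (hK : IsCompact K) :
    ∃ C : ℝ, 0 < C ∧ ∀ x ∈ K, ω x ≤ C := by
  obtain ⟨C, hC⟩ := ω.exists_nhds_one_le
  have h : ∀ x ∈ K, ∃ t ∈ 𝓝[K] x, ∃ D : ℝ, 0 < D ∧ ∀ y ∈ t, ω y ≤ D := by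
    intro x _
    refine ⟨{y | ω (x⁻¹ * y) ≤ C}, mem_nhdsWithin_of_mem_nhds ?_, ω x * C, ?_, ?_⟩
    · have : Tendsto (fun y => x⁻¹ * y) (𝓝 x) (𝓝 1) := by
        simpa using (continuous_const_mul x⁻¹).tendsto x
      exact this hC
    · exact mul_pos (ω.pos' x) ((ω.pos' _).trans_le hC.self_of_nhds)
    · intro y hy
      calc ω y = ω (x * (x⁻¹ * y)) := by rw [mul_inv_cancel_left]
        _ ≤ ω x * ω (x⁻¹ * y) := ω.mul_le' _ _
        _ ≤ _ := mul_le_mul_of_nonneg_left hy (ω.pos' x).le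
  refine hK.induction_on (p := fun K => ∃ C : ℝ, 0 < C ∧ ∀ x ∈ K, ω x ≤ C)
    ⟨1, one_pos, by simp⟩ ?_ ?_ h
  · rintro s t hst ⟨C, h0, hC⟩
    exact ⟨C, h0, fun x hx => hC x (hst hx)⟩
  · rintro s t ⟨C, h0, hC⟩ ⟨D, h1, hD⟩
    refine ⟨max C D, lt_max_of_lt_left h0, ?_⟩
    rintro x (hx | hx)
    · exact (hC x hx).trans (le_max_left _ _)
    · exact (hD x hx).trans (le_max_right _ _)

/-- A weight is bounded away from zero on compact sets. -/
theorem Weight.exists_pos_le_of_isCompact {K : Set G} (hK : IsCompact K) :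
    ∃ c : ℝ, 0 < c ∧ ∀ x ∈ K, c ≤ ω x := by
  obtain ⟨C, h0, hC⟩ := ω.exists_le_of_isCompact hK.inv
  refine ⟨ω 1 / C, div_pos (ω.pos' 1) h0, fun x hx => ?_⟩
  rw [div_le_iff₀ h0]
  calc ω 1 = ω (x * x⁻¹) := by rw [mul_inv_cancel]
    _ ≤ ω x * ω x⁻¹ := ω.mul_le' _ _
    _ ≤ _ := mul_le_mul_of_nonneg_left (hC _ (by simpa using hx)) (ω.pos' x).le

instance : IsFiniteMeasureOnCompacts ω.measure where
  lt_top_of_isCompact K hK := by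
    obtain ⟨C, h0, hC⟩ := ω.exists_le_of_isCompact hK.closure
    refine (measure_mono (subset_closure (s := K))).trans_lt ?_
    rw [Weight.measure, withDensity_apply _ isClosed_closure.measurableSet]
    refine (setLIntegral_mono (g := fun _ => ENNReal.ofReal C) measurable_const
      fun x hx => ENNReal.ofReal_le_ofReal (hC x hx)).trans_lt ?_
    rw [setLIntegral_const]
    exact ENNReal.mul_lt_top ENNReal.ofReal_lt_top hK.closure.measure_lt_top

/-- The Beurling algebra `L¹(G, ω)`: classes modulo null sets of measurable `f : G → ℂ` with
`‖f‖ = ∫ |f(x)| ω(x) dx < ∞` (see `L1.norm_eq`). -/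
abbrev L1 : Type _ := Lp ℂ 1 ω.measure

theorem L1.enorm_eq (f : L1 ω) :
    ‖f‖ₑ = ∫⁻ x, ENNReal.ofReal (ω x) * ‖f x‖ₑ ∂(Measure.haar : Measure G) := by
  rw [Lp.enorm_def, eLpNorm_one_eq_lintegral_enorm, ω.lintegral_measure]

theorem L1.norm_eq (f : L1 ω) : ‖f‖ = ∫ x, ‖f x‖ * ω x ∂(Measure.haar : Measure G) := by
  rw [← toReal_enorm, L1.enorm_eq, integral_eq_lintegral_of_nonneg_ae]
  · congr 1
    refine lintegral_congr fun x => ?_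
    rw [mul_comm, ENNReal.ofReal_mul (norm_nonneg _), ofReal_norm]
  · exact ae_of_all _ fun x => mul_nonneg (norm_nonneg _) (ω.pos' x).le
  · exact ((ω.aestronglyMeasurable_measure.1 (Lp.aestronglyMeasurable f)).norm).mul
      ω.measurable.aestronglyMeasurable

theorem L1.integrable (f : L1 ω) :
    Integrable (fun x => ‖f x‖ * ω x) (Measure.haar : Measure G) := by
  refine ⟨((ω.aestronglyMeasurable_measure.1 (Lp.aestronglyMeasurable f)).norm).mul
      ω.measurable.aestronglyMeasurable, ?_⟩
  have : (∫⁻ x, ‖‖f x‖ * ω x‖ₑ ∂(Measure.haar : Measure G)) = ‖f‖ₑ := by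
    rw [L1.enorm_eq]
    refine lintegral_congr fun x => ?_
    rw [enorm_mul, enorm_norm, mul_comm, Real.enorm_of_nonneg (ω.pos' x).le]
  rw [HasFiniteIntegral, this]
  exact enorm_lt_top

variable {ω} in
theorem ae_comp {e : G → G} (he : MeasurePreserving e (Measure.haar : Measure G) Measure.haar)
    {g h : G → ℂ} (hgh : g =ᵐ[ω.measure] h) :
    (fun x => g (e x)) =ᵐ[ω.measure] fun x => h (e x) := by
  have h1 : ∀ᵐ x ∂(Measure.haar : Measure G), g x = h x :=
    (Weight.ae_measure ω (p := fun x => g x = h x)).1 hgh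
  have h2 : ∀ᵐ x ∂(Measure.haar : Measure G), g (e x) = h (e x) :=
    he.quasiMeasurePreserving.ae (p := fun x => g x = h x) h1
  exact (Weight.ae_measure ω (p := fun x => g (e x) = h (e x))).2 h2

section Composition

variable {ω}

theorem lintegral_comp_le (e : G ≃ₜ G)
    (he : MeasurePreserving e (Measure.haar : Measure G) Measure.haar)
    (C : ℝ) (hC : ∀ x, ω (e.symm x) ≤ C * ω x) (g : G → ℂ) :
    ∫⁻ x, ‖g (e x)‖ₑ ∂ω.measure ≤ ENNReal.ofReal C * ∫⁻ x, ‖g x‖ₑ ∂ω.measure := by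
  have hC0 : 0 ≤ C := by
    by_contra! h
    have := (hC 1).trans_lt (mul_neg_of_neg_of_pos h (ω.pos' 1))
    exact absurd (ω.pos' (e.symm 1)) (by linarith)
  rw [ω.lintegral_measure, ω.lintegral_measure, ← lintegral_const_mul' _ _ ENNReal.ofReal_ne_top]
  calc ∫⁻ x, ENNReal.ofReal (ω x) * ‖g (e x)‖ₑ ∂(Measure.haar : Measure G)
      = ∫⁻ x, ENNReal.ofReal (ω (e.symm (e x))) * ‖g (e x)‖ₑ ∂(Measure.haar : Measure G) := by simp
    _ = ∫⁻ x, ENNReal.ofReal (ω (e.symm x)) * ‖g x‖ₑ ∂(Measure.haar : Measure G) :=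
        he.lintegral_comp_emb e.measurableEmbedding
          (fun x => ENNReal.ofReal (ω (e.symm x)) * ‖g x‖ₑ)
    _ ≤ _ := by
        refine lintegral_mono fun x => ?_
        rw [← mul_assoc, ← ENNReal.ofReal_mul hC0]
        gcongr
        exact hC x

theorem memLp_comp (e : G ≃ₜ G)
    (he : MeasurePreserving e (Measure.haar : Measure G) Measure.haar)
    (C : ℝ) (hC : ∀ x, ω (e.symm x) ≤ C * ω x) {g : G → ℂ} (hg : MemLp g 1 ω.measure) :
    MemLp (fun x => g (e x)) 1 ω.measure := by
  refine ⟨?_, ?_⟩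
  · rw [ω.aestronglyMeasurable_measure]
    exact (ω.aestronglyMeasurable_measure.1 hg.1).comp_measurePreserving he
  · rw [eLpNorm_one_eq_lintegral_enorm]
    refine (lintegral_comp_le e he C hC g).trans_lt (ENNReal.mul_lt_top ENNReal.ofReal_lt_top ?_)
    rw [← eLpNorm_one_eq_lintegral_enorm]
    exact hg.2

/-- Composition with a homeomorphism `e` of `G` that preserves Haar measure and distorts the weight by
at most a constant factor, as a bounded operator `f ↦ f ∘ e` of `L¹(G, ω)`. -/
def compL (e : G ≃ₜ G)
    (he : MeasurePreserving e (Measure.haar : Measure G) Measure.haar)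
    (C : ℝ) (hC : ∀ x, ω (e.symm x) ≤ C * ω x) : L1 ω →L[ℂ] L1 ω :=
  LinearMap.mkContinuous
    { toFun := fun f => (memLp_comp e he C hC (Lp.memLp f)).toLp _
      map_add' := fun f g => by
        refine Lp.ext ((MemLp.coeFn_toLp _).trans ((ae_comp he (Lp.coeFn_add f g)).trans ?_))
        filter_upwards [Lp.coeFn_add ((memLp_comp e he C hC (Lp.memLp f)).toLp _)
          ((memLp_comp e he C hC (Lp.memLp g)).toLp _),
          (memLp_comp e he C hC (Lp.memLp f)).coeFn_toLp,
          (memLp_comp e he C hC (Lp.memLp g)).coeFn_toLp] with x h1 h2 h3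
        rw [h1, Pi.add_apply, Pi.add_apply, h2, h3]
      map_smul' := fun c f => by
        refine Lp.ext ((MemLp.coeFn_toLp _).trans ((ae_comp he (Lp.coeFn_smul c f)).trans ?_))
        filter_upwards [Lp.coeFn_smul c ((memLp_comp e he C hC (Lp.memLp f)).toLp _),
          (memLp_comp e he C hC (Lp.memLp f)).coeFn_toLp] with x h1 h2
        rw [RingHom.id_apply, h1, Pi.smul_apply, Pi.smul_apply, h2] } C (by
    intro f
    have hC0 : 0 ≤ C := by
      by_contra! h
      have := (hC 1).trans_lt (mul_neg_of_neg_of_pos h (ω.pos' 1))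
      exact absurd (ω.pos' (e.symm 1)) (by linarith)
    have h1 := lintegral_comp_le e he C hC f
    rw [← eLpNorm_one_eq_lintegral_enorm, ← eLpNorm_one_eq_lintegral_enorm] at h1
    show ‖(memLp_comp e he C hC (Lp.memLp f)).toLp _‖ ≤ _
    rw [Lp.norm_toLp, Lp.norm_def]
    refine (ENNReal.toReal_mono (ENNReal.mul_ne_top ENNReal.ofReal_ne_top
      (Lp.memLp f).2.ne) h1).trans_eq ?_
    rw [ENNReal.toReal_mul, ENNReal.toReal_ofReal hC0])

theorem coeFn_compL (e : G ≃ₜ G)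
    (he : MeasurePreserving e (Measure.haar : Measure G) Measure.haar)
    (C : ℝ) (hC : ∀ x, ω (e.symm x) ≤ C * ω x) (f : L1 ω) : compL e he C hC f =ᵐ[ω.measure] fun x => f (e x) :=
  MemLp.coeFn_toLp (memLp_comp e he C hC (Lp.memLp f))

theorem norm_compL_le (e : G ≃ₜ G)
    (he : MeasurePreserving e (Measure.haar : Measure G) Measure.haar)
    (C : ℝ) (hC : ∀ x, ω (e.symm x) ≤ C * ω x) (hC0 : 0 ≤ C) (f : L1 ω) : ‖compL e he C hC f‖ ≤ C * ‖f‖ :=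
  ContinuousLinearMap.le_of_opNorm_le _ (LinearMap.mkContinuous_norm_le _ hC0 _) f

end Composition

/-- Left translation: `(translate ω y f)(x) = f(y⁻¹ x)`. -/
def translate (y : G) : L1 ω →L[ℂ] L1 ω :=
  compL (Homeomorph.mulLeft y⁻¹) (measurePreserving_mul_left _ y⁻¹) (ω y) (fun x => by
    show ω (y⁻¹⁻¹ * x) ≤ _
    rw [inv_inv]
    exact ω.mul_le' y x)

theorem coeFn_translate (y : G) (f : L1 ω) :
    translate ω y f =ᵐ[ω.measure] fun x => f (y⁻¹ * x) :=
  coeFn_compL _ _ _ _ f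

theorem norm_translate_le (y : G) (f : L1 ω) : ‖translate ω y f‖ ≤ ω y * ‖f‖ :=
  norm_compL_le _ _ _ _ (ω.pos' y).le f

theorem translate_mul (y z : G) (f : L1 ω) :
    translate ω (y * z) f = translate ω y (translate ω z f) := by
  refine Lp.ext ((coeFn_translate ω _ f).trans (EventuallyEq.trans ?_
    (coeFn_translate ω y _).symm))
  refine EventuallyEq.trans ?_ (ae_comp (measurePreserving_mul_left _ y⁻¹)
    (coeFn_translate ω z f)).symm
  simp [mul_assoc]

theorem translate_one (f : L1 ω) : translate ω 1 f = f :=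
  Lp.ext ((coeFn_translate ω 1 f).trans (by simp))


/-- On the Haar measure, compactly supported continuous functions are dense in `L¹`. -/
theorem exists_compactSupport_approx_haar {f : G → ℂ}
    (hf : Integrable f (Measure.haar : Measure G)) {ε : ℝ} (hε : 0 < ε) :
    ∃ g : G → ℂ, HasCompactSupport g ∧ (∫ x, ‖f x - g x‖ ∂(Measure.haar : Measure G)) ≤ ε ∧
      Continuous g ∧ Integrable g (Measure.haar : Measure G) := by
  set μ : Measure G := Measure.haar
  have key : ∃ g : G → ℂ, eLpNorm (f - g) 1 μ ≤ ENNReal.ofReal ε ∧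
      (Continuous g ∧ HasCompactSupport g) := by
    refine (memLp_one_iff_integrable.2 hf).induction_dense ENNReal.one_ne_top
      (fun g : G → ℂ => Continuous g ∧ HasCompactSupport g) ?_ ?_ ?_ (by simpa using hε)
    · intro c t ht htμ ε hε
      obtain ⟨η, ηpos, hη⟩ := exists_eLpNorm_indicator_le (μ := μ) ENNReal.one_ne_top c hε
      have hη' : ((η / 2 : ℝ≥0) : ℝ≥0∞) ≠ 0 := by
        exact_mod_cast (half_pos ηpos).ne'
      obtain ⟨s, st, s_compact, s_closed, μs⟩ := ht.exists_isCompact_isClosed_sdiff_lt htμ.ne hη'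
      obtain ⟨V, sV, V_open, -, hV⟩ := s_closed.measurableSet.exists_isOpen_sdiff_lt
        ((measure_mono st).trans_lt htμ).ne hη'
      obtain ⟨χ, χ1, χ0, χs, χ01⟩ := exists_continuous_one_zero_of_isCompact s_compact
        V_open.isClosed_compl (disjoint_compl_right_iff_subset.2 sV)
      refine ⟨fun x => (χ x : ℂ) * c, ?_,
        (Complex.continuous_ofReal.comp χ.continuous).mul continuous_const, ?_⟩
      · refine (eLpNorm_mono (g := ((V \ s) ∪ (t \ s)).indicator fun _ => c) fun x => ?_).trans
          (hη _ ?_)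
        · rw [Pi.sub_apply]
          by_cases hs : x ∈ s
          · simp [χ1 hs, st hs]
          · by_cases hVt : x ∈ (V \ s) ∪ (t \ s)
            · rw [indicator_of_mem hVt]
              by_cases hxt : x ∈ t
              · rw [indicator_of_mem hxt]
                have : (χ x : ℂ) * c - c = ((χ x - 1 : ℝ) : ℂ) * c := by push_cast; ring
                rw [this, norm_mul, Complex.norm_real, Real.norm_eq_abs]
                refine mul_le_of_le_one_left (norm_nonneg _) (abs_le.2 ⟨?_, ?_⟩) <;>
                linarith [(χ01 x).1, (χ01 x).2]
              · rw [indicator_of_notMem hxt, sub_zero, norm_mul, Complex.norm_real,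
                  Real.norm_of_nonneg (χ01 x).1]
                exact mul_le_of_le_one_left (norm_nonneg _) (χ01 x).2
            · have hxV : x ∉ V := fun h => hVt (Or.inl ⟨h, hs⟩)
              have hxt : x ∉ t := fun h => hVt (Or.inr ⟨h, hs⟩)
              have : χ x = 0 := χ0 hxV
              simp [this, hxt]
        · refine (measure_union_le _ _).trans ((add_le_add hV.le μs.le).trans_eq ?_)
          rw [← ENNReal.coe_add, add_halves]
      · refine HasCompactSupport.mul_right (f := fun x => (χ x : ℂ)) ?_
        exact χs.comp_left (g := fun r : ℝ => (r : ℂ)) Complex.ofReal_zero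
    · exact fun f g hf hg => ⟨hf.1.add hg.1, hf.2.add hg.2⟩
    · exact fun f hf => (hf.1.stronglyMeasurable_of_hasCompactSupport hf.2).aestronglyMeasurable
  obtain ⟨g, hg, hgc, hgs⟩ := key
  have hgi : Integrable g μ := hgc.integrable_of_hasCompactSupport hgs
  refine ⟨g, hgs, ?_, hgc, hgi⟩
  rw [eLpNorm_one_eq_lintegral_enorm] at hg
  have := integral_norm_eq_lintegral_enorm (hf.sub hgi).1
  simp only [Pi.sub_apply] at this hg
  rw [this]
  exact ENNReal.toReal_le_of_le_ofReal hε.le hg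

variable {ω} in
theorem memLp_of_compact {k : G → ℂ} (hk : Continuous k) (hs : HasCompactSupport k) :
    MemLp k 1 ω.measure :=
  hk.memLp_of_hasCompactSupport hs

variable {ω} in
theorem exists_compactSupport_approx (f : L1 ω) {ε : ℝ} (hε : 0 < ε) :
    ∃ (k : G → ℂ) (hk : Continuous k) (hs : HasCompactSupport k),
      ‖f - (memLp_of_compact hk hs).toLp k‖ ≤ ε := by
  set μ : Measure G := Measure.haar
  have hfm : AEStronglyMeasurable f μ :=
    ω.aestronglyMeasurable_measure.1 (Lp.aestronglyMeasurable f)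
  have hωm : AEStronglyMeasurable (fun x => (ω x : ℂ)) μ :=
    (Complex.measurable_ofReal.comp ω.measurable).aestronglyMeasurable
  have hF : Integrable (fun x => f x * (ω x : ℂ)) μ := by
    refine (L1.integrable ω f).mono (hfm.mul hωm) (ae_of_all _ fun x => ?_)
    simp [abs_of_pos (ω.pos' x)]
  obtain ⟨h, hhs, hhF, hhc, hhi⟩ := exists_compactSupport_approx_haar hF (half_pos hε)
  obtain ⟨χ, hχ1, -, hχs, hχ01⟩ := exists_continuous_one_zero_of_isCompact (X := G)
    (s := tsupport h) (t := ∅) hhs isClosed_empty (disjoint_empty _)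
  obtain ⟨C, hC0, hC⟩ := ω.exists_le_of_isCompact (K := tsupport χ) hχs
  obtain ⟨c, hc0, hc⟩ := ω.exists_pos_le_of_isCompact (K := tsupport h) hhs
  have hu : Integrable (fun x => h x / (ω x : ℂ)) μ := by
    refine (hhi.norm.const_mul c⁻¹).mono ?_ (ae_of_all _ fun x => ?_)
    · simp_rw [div_eq_mul_inv]
      exact hhi.1.mul (Complex.measurable_ofReal.comp ω.measurable).inv.aestronglyMeasurable
    · by_cases hx : x ∈ tsupport h
      · rw [norm_div, Complex.norm_real, Real.norm_of_nonneg (ω.pos' x).le, norm_mul, norm_norm,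
          norm_inv, Real.norm_of_nonneg hc0.le, div_eq_inv_mul]
        gcongr
        exact hc x hx
      · simp [image_eq_zero_of_notMem_tsupport hx]
  obtain ⟨k, hks, hku, hkc, hki⟩ :=
    exists_compactSupport_approx_haar hu (ε := ε / (2 * C)) (by positivity)
  have hcont : Continuous fun x => (χ x : ℂ) * k x :=
    (Complex.continuous_ofReal.comp χ.continuous).mul hkc
  have hsupp : HasCompactSupport fun x => (χ x : ℂ) * k x := hks.mul_left
  refine ⟨_, hcont, hsupp, ?_⟩
  have hae : ∀ᵐ x ∂μ, (f - (memLp_of_compact (ω := ω) hcont hsupp).toLp _ : L1 ω) x =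
      f x - χ x * k x := by
    refine ω.ae_measure.1 ?_
    filter_upwards [Lp.coeFn_sub f ((memLp_of_compact (ω := ω) hcont hsupp).toLp _),
      (memLp_of_compact (ω := ω) hcont hsupp).coeFn_toLp] with x h1 h2
    rw [h1, Pi.sub_apply, h2]
  rw [L1.norm_eq]
  calc _ ≤ ∫ x, (‖f x * (ω x : ℂ) - h x‖ + C * ‖h x / (ω x : ℂ) - k x‖) ∂μ := by
        refine integral_mono_of_nonneg
          (ae_of_all _ fun x => mul_nonneg (norm_nonneg _) (ω.pos' x).le)
          ((hF.sub hhi).norm.add ((hu.sub hki).norm.const_mul C)) ?_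
        filter_upwards [hae] with x hx
        have hω : (ω x : ℂ) ≠ 0 := by exact_mod_cast (ω.pos' x).ne'
        have e1 : h x = χ x * (h x / (ω x : ℂ)) * ω x := by
          by_cases hxs : x ∈ tsupport h
          · rw [hχ1 hxs]; simp [hω]
          · simp [image_eq_zero_of_notMem_tsupport hxs]
        have e2 : (f x - χ x * k x) * (ω x : ℂ) =
            (f x * (ω x : ℂ) - h x) + (χ x * ω x : ℂ) * (h x / (ω x : ℂ) - k x) := by
          linear_combination e1
        have e3 : ‖(χ x * ω x : ℂ)‖ ≤ C := by
          rw [norm_mul, Complex.norm_real, Complex.norm_real,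
            Real.norm_of_nonneg (ω.pos' x).le, Real.norm_of_nonneg (hχ01 x).1]
          by_cases hxs : x ∈ tsupport χ
          · exact (mul_le_of_le_one_left (ω.pos' x).le (hχ01 x).2).trans (hC x hxs)
          · rw [image_eq_zero_of_notMem_tsupport hxs, zero_mul]; exact hC0.le
        calc ‖(f - (memLp_of_compact (ω := ω) hcont hsupp).toLp _ : L1 ω) x‖ * ω x
            = ‖(f x - χ x * k x) * (ω x : ℂ)‖ := by
              rw [hx, norm_mul, Complex.norm_real, Real.norm_of_nonneg (ω.pos' x).le]
          _ ≤ _ := by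
              rw [e2]
              refine (norm_add_le _ _).trans ?_
              rw [norm_mul]
              gcongr
    _ = (∫ x, ‖f x * (ω x : ℂ) - h x‖ ∂μ) + C * ∫ x, ‖h x / (ω x : ℂ) - k x‖ ∂μ := by
        rw [← integral_const_mul]
        exact integral_add (hF.sub hhi).norm ((hu.sub hki).norm.const_mul C)
    _ ≤ ε / 2 + C * (ε / (2 * C)) := by gcongr
    _ = ε := by field_simp; ring

variable {ω} in
theorem tendsto_translate_of_compact {k : G → ℂ} (hk : Continuous k) (hs : HasCompactSupport k) :
    Tendsto (fun y => ‖translate ω y ((memLp_of_compact hk hs).toLp k) -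
      (memLp_of_compact hk hs).toLp k‖) (𝓝 1) (𝓝 0) := by
  obtain ⟨V, hV, hV1⟩ := exists_compact_mem_nhds (1 : G)
  have hc : ContinuousOn (fun y => ∫ x, ‖k (y⁻¹ * x) - k x‖ ∂ω.measure) V := by
    refine continuousOn_integral_of_compact_support (k := V * tsupport k ∪ tsupport k)
      ((hV.mul hs).union hs) ?_ ?_
    · refine Continuous.continuousOn ?_
      show Continuous fun p : G × G => ‖k (p.1⁻¹ * p.2) - k p.2‖
      fun_prop
    · intro y x hy hx
      have h1 : k x = 0 := image_eq_zero_of_notMem_tsupport fun h => hx (Or.inr h)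
      have h2 : k (y⁻¹ * x) = 0 := image_eq_zero_of_notMem_tsupport fun h =>
        hx (Or.inl ⟨y, hy, _, h, mul_inv_cancel_left y x⟩)
      simp [h1, h2]
  have h1 := (hc.continuousAt hV1).tendsto
  simp only [inv_one, one_mul, sub_self, norm_zero, integral_zero] at h1
  refine h1.congr fun y => ?_
  rw [L1.norm_eq_integral_norm]
  refine integral_congr_ae ?_
  have hk' := (memLp_of_compact (ω := ω) hk hs).coeFn_toLp
  filter_upwards [Lp.coeFn_sub (translate ω y ((memLp_of_compact hk hs).toLp k))
    ((memLp_of_compact hk hs).toLp k), coeFn_translate ω y ((memLp_of_compact hk hs).toLp k),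
    hk', ae_comp (measurePreserving_mul_left _ y⁻¹) hk'] with x h1 h2 h3 h4
  rw [h1, Pi.sub_apply, h2, h3, h4]

theorem continuous_translate (f : L1 ω) : Continuous fun y => translate ω y f := by
  have h0 : Tendsto (fun y => ‖translate ω y f - f‖) (𝓝 1) (𝓝 0) := by
    obtain ⟨C, hC⟩ := ω.exists_nhds_one_le
    have hCpos : 0 < C := (ω.pos' 1).trans_le hC.self_of_nhds
    rw [Metric.tendsto_nhds]
    intro ε hε
    obtain ⟨k, hk, hs, hfk⟩ := exists_compactSupport_approx f (ε := ε / (2 * (C + 1)))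
      (by positivity)
    have h1 := tendsto_translate_of_compact (ω := ω) hk hs
    set k' := (memLp_of_compact (ω := ω) hk hs).toLp k
    filter_upwards [hC, h1.eventually (gt_mem_nhds (half_pos hε))] with y hy hky
    rw [dist_zero_right, norm_norm]
    have e : translate ω y f - f =
        translate ω y (f - k') + (translate ω y k' - k') - (f - k') := by
      rw [map_sub]; abel
    rw [e]
    have h2 : ‖translate ω y (f - k')‖ ≤ C * (ε / (2 * (C + 1))) :=
      (norm_translate_le ω y _).trans
        (mul_le_mul hy hfk (norm_nonneg _) hCpos.le)
    have h3 : C * (ε / (2 * (C + 1))) + ε / (2 * (C + 1)) = ε / 2 := by field_simp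
    have h4 := norm_sub_le (translate ω y (f - k') + (translate ω y k' - k')) (f - k')
    have h5 := norm_add_le (translate ω y (f - k')) (translate ω y k' - k')
    linarith
  rw [continuous_iff_continuousAt]
  intro y₀
  rw [ContinuousAt, tendsto_iff_norm_sub_tendsto_zero]
  have h1 : Tendsto (fun y => y₀⁻¹ * y) (𝓝 y₀) (𝓝 1) := by
    simpa using (continuous_const_mul y₀⁻¹).tendsto y₀
  have h2 : Tendsto (fun y => ω y₀ * ‖translate ω (y₀⁻¹ * y) f - f‖) (𝓝 y₀) (𝓝 0) := by
    simpa using (h0.comp h1).const_mul (ω y₀)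
  refine squeeze_zero (fun _ => norm_nonneg _) (fun y => ?_) h2
  have : translate ω y f - translate ω y₀ f =
      translate ω y₀ (translate ω (y₀⁻¹ * y) f - f) := by
    rw [map_sub, ← translate_mul, mul_inv_cancel_left]
  rw [this]
  exact norm_translate_le ω y₀ _

theorem integrable_smul_translate (f g : L1 ω) :
    Integrable (fun y => f y • translate ω y g) (Measure.haar : Measure G) := by
  set μ : Measure G := Measure.haar
  refine ((L1.integrable ω f).mul_const ‖g‖).mono' ?_ (ae_of_all _ fun y => ?_)
  · choose k hk hs hfk using fun n : ℕ =>
      exists_compactSupport_approx f (ε := 1 / ((n : ℝ) + 1)) (by positivity)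
    have hlim : Tendsto (fun n => (memLp_of_compact (ω := ω) (hk n) (hs n)).toLp (k n))
        atTop (𝓝 f) := by
      rw [tendsto_iff_norm_sub_tendsto_zero]
      refine squeeze_zero (fun _ => norm_nonneg _) (fun n => ?_)
        tendsto_one_div_add_atTop_nhds_zero_nat
      rw [norm_sub_rev]
      exact hfk n
    obtain ⟨φ, -, hφ⟩ := (tendstoInMeasure_of_tendsto_Lp hlim).exists_seq_tendsto_ae
    have hφ' : ∀ᵐ y ∂μ, Tendsto (fun n => k (φ n) y) atTop (𝓝 (f y)) := by
      refine ω.ae_measure.1 ?_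
      have hall : ∀ᵐ y ∂ω.measure, ∀ n : ℕ,
          (memLp_of_compact (ω := ω) (hk n) (hs n)).toLp (k n) y = k n y :=
        ae_all_iff.2 fun n => MemLp.coeFn_toLp _
      filter_upwards [hφ, hall] with y h1 h2
      exact h1.congr fun n => h2 _
    refine aestronglyMeasurable_of_tendsto_ae (u := atTop)
      (f := fun n y => k (φ n) y • translate ω y g) (fun n => ?_) ?_
    · refine (Continuous.stronglyMeasurable_of_hasCompactSupport
        ((hk _).smul (continuous_translate ω g)) ?_).aestronglyMeasurable
      exact (hs _).smul_right
    · filter_upwards [hφ'] with y hy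
      exact hy.smul_const _
  · rw [norm_smul, mul_assoc]
    gcongr
    exact norm_translate_le ω y g

/-- The convolution product `(f * g)(x) = ∫ f(y) g(y⁻¹ x) dy`, as the integral of the function
`y ↦ f(y) • g(y⁻¹ ·)` with values in the Banach space `L¹(G, ω)`; the integrand is integrable by
`integrable_smul_translate`. For the pointwise formula see `L1.mul_ae_eq`, which determines the product
as compactly supported continuous functions are dense and the product is continuous. -/
def conv (f g : L1 ω) : L1 ω := ∫ y, f y • translate ω y g ∂(Measure.haar : Measure G)

theorem norm_conv_le (f g : L1 ω) : ‖conv ω f g‖ ≤ ‖f‖ * ‖g‖ := by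
  rw [L1.norm_eq ω f, ← integral_mul_const]
  refine norm_integral_le_of_norm_le ((L1.integrable ω f).mul_const ‖g‖) (ae_of_all _ fun y => ?_)
  rw [norm_smul, mul_assoc]
  gcongr
  exact norm_translate_le ω y g

theorem conv_add_left (f₁ f₂ g : L1 ω) : conv ω (f₁ + f₂) g = conv ω f₁ g + conv ω f₂ g := by
  rw [conv, conv, conv, ← integral_add (integrable_smul_translate ω f₁ g)
    (integrable_smul_translate ω f₂ g)]
  refine integral_congr_ae ?_
  have h : ∀ᵐ y ∂(Measure.haar : Measure G), (f₁ + f₂ : L1 ω) y = f₁ y + f₂ y :=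
    ω.ae_measure.1 (Lp.coeFn_add f₁ f₂)
  filter_upwards [h] with y hy
  rw [hy, add_smul]

theorem conv_smul_left (c : ℂ) (f g : L1 ω) : conv ω (c • f) g = c • conv ω f g := by
  rw [conv, conv, ← integral_smul]
  refine integral_congr_ae ?_
  have h : ∀ᵐ y ∂(Measure.haar : Measure G), (c • f : L1 ω) y = c * f y :=
    ω.ae_measure.1 (Lp.coeFn_smul c f)
  filter_upwards [h] with y hy
  rw [hy, mul_smul]

theorem conv_add_right (f g₁ g₂ : L1 ω) : conv ω f (g₁ + g₂) = conv ω f g₁ + conv ω f g₂ := by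
  rw [conv, conv, conv, ← integral_add (integrable_smul_translate ω f g₁)
    (integrable_smul_translate ω f g₂)]
  simp only [map_add, smul_add]

theorem conv_smul_right (c : ℂ) (f g : L1 ω) : conv ω f (c • g) = c • conv ω f g := by
  rw [conv, conv, ← integral_smul]
  simp only [map_smul, smul_comm c]

/-- Convolution on the right by a fixed element. -/
def convR (g : L1 ω) : L1 ω →L[ℂ] L1 ω :=
  LinearMap.mkContinuous
    { toFun := fun f => conv ω f g
      map_add' := fun f₁ f₂ => conv_add_left ω f₁ f₂ g
      map_smul' := fun c f => conv_smul_left ω c f g } ‖g‖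
    fun f => (norm_conv_le ω f g).trans_eq (mul_comm _ _)

theorem translate_conv (y : G) (f g : L1 ω) :
    translate ω y (conv ω f g) = conv ω (translate ω y f) g := by
  rw [conv, ← (translate ω y).integral_comp_comm (integrable_smul_translate ω f g), conv,
    ← integral_mul_left_eq_self (fun z => (translate ω y f) z • translate ω z g) y]
  refine integral_congr_ae ?_
  have h : ∀ᵐ z ∂(Measure.haar : Measure G), (translate ω y f) (y * z) = f z := by
    have h1 : ∀ᵐ z ∂(Measure.haar : Measure G), (translate ω y f) z = f (y⁻¹ * z) :=
      ω.ae_measure.1 (coeFn_translate ω y f)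
    have h2 := (measurePreserving_mul_left (Measure.haar : Measure G) y).quasiMeasurePreserving.ae
      (p := fun z => (translate ω y f) z = f (y⁻¹ * z)) h1
    simpa using h2
  filter_upwards [h] with z hz
  rw [hz, translate_mul, map_smul]

theorem conv_assoc (f g h : L1 ω) : conv ω (conv ω f g) h = conv ω f (conv ω g h) := by
  have h1 : conv ω (conv ω f g) h = convR ω h (conv ω f g) := rfl
  rw [h1, conv, ← (convR ω h).integral_comp_comm (integrable_smul_translate ω f g), conv]
  refine integral_congr_ae (ae_of_all _ fun y => ?_)
  show convR ω h (f y • translate ω y g) = f y • translate ω y (conv ω g h)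
  rw [map_smul, translate_conv]
  rfl

/-- `L¹(G, ω)` is a (not necessarily unital) Banach algebra under convolution. -/
instance : NonUnitalNormedRing (L1 ω) :=
  { (inferInstance : NormedAddCommGroup (L1 ω)) with
    mul := conv ω
    left_distrib := conv_add_right ω
    right_distrib := conv_add_left ω
    zero_mul := fun f => by
      have h := conv_smul_left ω 0 0 f
      rw [zero_smul, zero_smul] at h
      exact h
    mul_zero := fun f => by
      have h := conv_smul_right ω 0 f 0
      rw [zero_smul, zero_smul] at h
      exact h
    mul_assoc := conv_assoc ω
    norm_mul_le := norm_conv_le ω }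

theorem L1.mul_def (f g : L1 ω) :
    f * g = ∫ y, f y • translate ω y g ∂(Measure.haar : Measure G) := rfl

instance : IsScalarTower ℂ (L1 ω) (L1 ω) := ⟨fun c f g => conv_smul_left ω c f g⟩
instance : SMulCommClass ℂ (L1 ω) (L1 ω) := ⟨fun c f g => (conv_smul_right ω c f g).symm⟩

/-- The product of `L¹(G, ω)` is convolution in the pointwise sense. -/
theorem L1.mul_ae_eq {f g : G → ℂ} (hf : Continuous f) (hfs : HasCompactSupport f)
    (hg : Continuous g) (hgs : HasCompactSupport g) :
    ((memLp_of_compact (ω := ω) hf hfs).toLp f * (memLp_of_compact (ω := ω) hg hgs).toLp g : L1 ω)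
      =ᵐ[Measure.haar] fun x => ∫ y, f y * g (y⁻¹ * x) ∂(Measure.haar : Measure G) := by
  set μ : Measure G := Measure.haar
  set f' : L1 ω := (memLp_of_compact (ω := ω) hf hfs).toLp f with hf'
  set g' : L1 ω := (memLp_of_compact (ω := ω) hg hgs).toLp g with hg'
  have hF : Continuous fun p : G × G => f p.2 * g (p.2⁻¹ * p.1) := by fun_prop
  have hFs : HasCompactSupport fun p : G × G => f p.2 * g (p.2⁻¹ * p.1) := by
    refine HasCompactSupport.intro ((hfs.mul hgs).prod hfs) ?_
    rintro ⟨x, y⟩ hxy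
    by_cases hy : y ∈ tsupport f
    · have : g (y⁻¹ * x) = 0 := image_eq_zero_of_notMem_tsupport fun h =>
        hxy ⟨⟨y, hy, _, h, mul_inv_cancel_left y x⟩, hy⟩
      simp [this]
    · simp [image_eq_zero_of_notMem_tsupport hy]
  have hcont : Continuous fun x => ∫ y, f y * g (y⁻¹ * x) ∂μ := by
    rw [← continuousOn_univ]
    refine continuousOn_integral_of_compact_support (k := tsupport f) hfs hF.continuousOn ?_
    intro x y _ hy
    simp [image_eq_zero_of_notMem_tsupport hy]
  have hsupp : HasCompactSupport fun x => ∫ y, f y * g (y⁻¹ * x) ∂μ := by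
    refine HasCompactSupport.intro (hfs.mul hgs) fun x hx => ?_
    have : ∀ y, f y * g (y⁻¹ * x) = 0 := fun y => by
      by_cases hy : y ∈ tsupport f
      · have : g (y⁻¹ * x) = 0 := image_eq_zero_of_notMem_tsupport fun h =>
          hx ⟨y, hy, _, h, mul_inv_cancel_left y x⟩
        simp [this]
      · simp [image_eq_zero_of_notMem_tsupport hy]
    simp [this]
  have hmem := memLp_of_compact (ω := ω) hcont hsupp
  refine ω.ae_measure.1 (Integrable.ae_eq_of_forall_setIntegral_eq _ _
    (memLp_one_iff_integrable.1 (Lp.memLp _)) (memLp_one_iff_integrable.1 hmem) fun S hS _ => ?_)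
  let Λ : L1 ω →L[ℂ] ℂ := LinearMap.mkContinuous
    { toFun := fun u => ∫ x in S, u x ∂ω.measure
      map_add' := fun u v => by
        rw [← integral_add (memLp_one_iff_integrable.1 (Lp.memLp u)).integrableOn
          (memLp_one_iff_integrable.1 (Lp.memLp v)).integrableOn]
        exact integral_congr_ae (ae_restrict_of_ae (Lp.coeFn_add u v))
      map_smul' := fun c u => by
        rw [RingHom.id_apply, ← integral_smul]
        exact integral_congr_ae (ae_restrict_of_ae (Lp.coeFn_smul c u)) } 1 (fun u => by
    rw [one_mul, L1.norm_eq_integral_norm]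
    exact (norm_integral_le_integral_norm _).trans (setIntegral_le_integral
      (memLp_one_iff_integrable.1 (Lp.memLp u)).norm (ae_of_all _ fun _ => norm_nonneg _)))
  have h1 : ∫ x in S, (f' * g' : L1 ω) x ∂ω.measure = Λ (f' * g') := rfl
  rw [h1, L1.mul_def, ← Λ.integral_comp_comm (integrable_smul_translate ω f' g'),
    integral_integral_swap_of_hasCompactSupport (f := fun x y => f y * g (y⁻¹ * x)) hF hFs]
  refine integral_congr_ae ?_
  have h2 : ∀ᵐ y ∂μ, f' y = f y := ω.ae_measure.1 (memLp_of_compact (ω := ω) hf hfs).coeFn_toLp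
  filter_upwards [h2] with y hy
  rw [map_smul, hy, smul_eq_mul, integral_const_mul]
  congr 1
  refine integral_congr_ae (ae_restrict_of_ae ((coeFn_translate ω y g').trans ?_))
  exact ae_comp (measurePreserving_mul_left _ y⁻¹) (memLp_of_compact (ω := ω) hg hgs).coeFn_toLp

section Central

variable [IsFCBar G]

theorem measurePreserving_conj (g : G) :
    MeasurePreserving (fun x => g⁻¹ * x * g) (Measure.haar : Measure G) Measure.haar :=
  (measurePreserving_mul_right _ g).comp (measurePreserving_mul_left _ g⁻¹)

/-- The operator `f ↦ f^g`, where `f^g(x) = f(g⁻¹ x g)`. -/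
def conjL (g : G) : L1 ω →L[ℂ] L1 ω :=
  compL ((Homeomorph.mulLeft g⁻¹).trans (Homeomorph.mulRight g)) (measurePreserving_conj g)
    (ω g * ω g⁻¹) (fun x => by
      show ω (g⁻¹⁻¹ * (x * g⁻¹)) ≤ _
      rw [inv_inv]
      calc ω (g * (x * g⁻¹)) ≤ ω g * (ω x * ω g⁻¹) := (ω.mul_le' _ _).trans
            (mul_le_mul_of_nonneg_left (ω.mul_le' _ _) (ω.pos' g).le)
        _ = _ := by ring)

theorem coeFn_conjL (g : G) (f : L1 ω) : conjL ω g f =ᵐ[ω.measure] fun x => f (g⁻¹ * x * g) :=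
  coeFn_compL _ _ _ _ f

theorem conjL_translate (g y : G) (f : L1 ω) :
    conjL ω g (translate ω (g⁻¹ * y * g) f) = translate ω y (conjL ω g f) := by
  refine Lp.ext ((coeFn_conjL ω g _).trans (EventuallyEq.trans ?_ (coeFn_translate ω y _).symm))
  refine (ae_comp (measurePreserving_conj g) (coeFn_translate ω (g⁻¹ * y * g) f)).trans ?_
  refine EventuallyEq.trans ?_
    (ae_comp (measurePreserving_mul_left _ y⁻¹) (coeFn_conjL ω g f)).symm
  refine ae_of_all _ fun x => ?_
  show f _ = f _
  congr 1
  group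

theorem conjL_conv (g : G) (f h : L1 ω) :
    conjL ω g (conv ω f h) = conv ω (conjL ω g f) (conjL ω g h) := by
  have he : MeasurableEmbedding fun x : G => g⁻¹ * x * g :=
    ((Homeomorph.mulLeft g⁻¹).trans (Homeomorph.mulRight g)).measurableEmbedding
  rw [conv, ← (conjL ω g).integral_comp_comm (integrable_smul_translate ω f h), conv,
    ← (measurePreserving_conj g).integral_comp he]
  refine integral_congr_ae ?_
  have h1 : ∀ᵐ y ∂(Measure.haar : Measure G), (conjL ω g f) y = f (g⁻¹ * y * g) :=
    ω.ae_measure.1 (coeFn_conjL ω g f)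
  filter_upwards [h1] with y hy
  rw [hy, map_smul, conjL_translate]

theorem conjL_eq_iff (g : G) (f : L1 ω) :
    conjL ω g f = f ↔ (fun x => f (g⁻¹ * x * g)) =ᵐ[Measure.haar] f := by
  constructor
  · intro h
    have h1 := (coeFn_conjL ω g f).symm
    rw [h] at h1
    exact ω.ae_measure.1 h1
  · intro h
    exact Lp.ext ((coeFn_conjL ω g f).trans (ω.ae_measure.2 h))

/-- The central Beurling algebra `ZL¹(G, ω)`: the subalgebra of all `f` in `L¹(G, ω)` with `f^g = f`
(almost everywhere) for all `g` in `G`, where `f^g(x) = f(g⁻¹ x g)`. -/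
def ZL1 : NonUnitalSubalgebra ℂ (L1 ω) where
  carrier := {f | ∀ g : G, (fun x => f (g⁻¹ * x * g)) =ᵐ[Measure.haar] f}
  zero_mem' g := (conjL_eq_iff ω g 0).1 (map_zero _)
  add_mem' {a b} ha hb g := (conjL_eq_iff ω g _).1 (by
    rw [map_add, (conjL_eq_iff ω g a).2 (ha g), (conjL_eq_iff ω g b).2 (hb g)])
  smul_mem' c a ha g := (conjL_eq_iff ω g _).1 (by
    rw [map_smul, (conjL_eq_iff ω g a).2 (ha g)])
  mul_mem' {a b} ha hb g := (conjL_eq_iff ω g _).1 (by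
    refine (conjL_conv ω g a b).trans ?_
    rw [(conjL_eq_iff ω g a).2 (ha g), (conjL_eq_iff ω g b).2 (hb g)]
    rfl)

/-- The norm of `ZL¹(G, ω)` is the one of `L¹(G, ω)`. -/
instance : NormedSpace ℂ (ZL1 ω) := inferInstanceAs (NormedSpace ℂ (ZL1 ω).toSubmodule)

instance : CompleteSpace (ZL1 ω) := by
  suffices h : IsClosed (ZL1 ω : Set (L1 ω)) from h.completeSpace_coe
  have : (ZL1 ω : Set (L1 ω)) = ⋂ g : G, {f | conjL ω g f = f} := by
    ext f
    simp only [mem_iInter]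
    exact forall_congr' fun g => (conjL_eq_iff ω g f).symm
  rw [this]
  exact isClosed_iInter fun g => isClosed_eq (conjL ω g).continuous continuous_id

end Central

end Beurling

end

/-!
The isomorphism comes from identifying both sides with the same space of vector-valued functions.
It is isometric, and no averaging projection of `L¹(G, ω)` onto `ZL¹(G, ω)` enters.

Write `νᵢ = ωᵢ dx` and `E = ZL¹(G₂, ω₂)`. Slicing, `u ↦ (x ↦ u (x, ·))`, identifies
`L¹(G₁ × G₂, ω₁ × ω₂)` with `L¹(ν₁; L¹(G₂, ω₂))` and scales norms by a constant (`sliceL_bijective`,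
`norm_eq_mul_norm_sliceL`). If `u` is central, then conjugating by elements `(1, g)` shows that almost
every slice lies in `E` (`sliceL_mem_ZL1`), and conjugating by elements `(g, 1)` shows that the slice
function is invariant under conjugation of its argument. So `ZL¹(G₁ × G₂, ω₁ × ω₂)` becomes the space of
conjugation invariant functions in `L¹(ν₁; E)`.

It remains to see that the latter is the projective tensor product of the invariant scalar functions
`ZL¹(G₁, ω₁)` with `E`. An invariant function `F` is a limit of simple functions `N ∘ F`, which are
again invariant (`exists_simpleFunc_invariant`). This gives the density of `ZL¹(G₁, ω₁) ⊗ E`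
(`exists_tensorToLp_approx`). It also shows that tensors `∑ 1_{A_c} ⊗ e_c` with disjoint invariant sets
`A_c` are dense in `ZL¹(G₁, ω₁) ⊗ E`; on these the projective norm is at most
`∑ ν₁(A_c) ‖e_c‖`, which is the norm in `L¹(ν₁; E)`, so that the map is isometric (`norm_tensorToLp`).

The groups need not be second countable, so the Borel σ-algebra of `G₁ × G₂` may be larger than the product
σ-algebra, and Haar measures need not be σ-finite. Slicing is therefore defined on compactly supported
continuous functions, which are measurable for the product σ-algebra, and extended by density. Fubini's
theorem for them follows from the uniqueness of Haar measure, applied to one side of a compact rectangle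
at a time (`exists_haar_rectangle`): Haar measure of `G₁ × G₂` is `κ` times the product of the Haar measures
of the factors. The constant `κ` also enters the convolution (`tensorL1_mul_tensorL1`), and
`f ⊗ h ↦ κ⁻¹ (f ⊗ h)` is both isometric and multiplicative.
-/

noncomputable section

namespace Beurling

open MeasureTheory Filter Topology Set
open scoped ENNReal NNReal TensorProduct Pointwise CompactlySupported

/-! ### Invariant integrable functions -/

section InvariantFunctions

variable {X ι : Type*} [MeasurableSpace X] {ν : Measure X} {γ : ι → X → X}
  {E : Type*} [NormedAddCommGroup E]

/-- Invariant integrable functions are approximated by invariant simple functions, for any family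
`γ` of quasi-measure-preserving maps. No averaging is involved: the approximation `SimpleFunc.approxOn` of `F` has the form `N ∘ F`,
so it inherits the invariance of `F`. -/
theorem exists_simpleFunc_invariant (hγ : ∀ i, Measure.QuasiMeasurePreserving (γ i) ν ν)
    {F : X → E} (hF : Integrable F ν) (hinv : ∀ i, (fun x => F (γ i x)) =ᵐ[ν] F)
    {ε : ℝ} (hε : 0 < ε) :
    ∃ s : SimpleFunc X E, Integrable s ν ∧ (∫ x, ‖s x - F x‖ ∂ν ≤ ε) ∧
      ∀ i, (fun x => s (γ i x)) =ᵐ[ν] s := by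
  borelize E
  -- `approxOn` needs a genuinely measurable representative, which is invariant as well
  set F' := hF.1.mk F
  have hFF' : F =ᵐ[ν] F' := hF.1.ae_eq_mk
  have hsm : StronglyMeasurable F' := hF.1.stronglyMeasurable_mk
  have hint : Integrable F' ν := hF.congr hFF'
  have : TopologicalSpace.SeparableSpace (range F' ∪ {0} : Set E) :=
    hsm.separableSpace_range_union_singleton
  have hinv' : ∀ i, ∀ᵐ x ∂ν, F' (γ i x) = F' x := fun i => by
    filter_upwards [hinv i, hFF', (hγ i).ae hFF'] with x h1 h2 h3
    rw [← h3, h1, h2]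
  have ht := SimpleFunc.tendsto_approxOn_range_L1_enorm hsm.measurable hint
  obtain ⟨n, hn⟩ := (ht.eventually (gt_mem_nhds (ENNReal.ofReal_pos.2 hε))).exists
  set s := SimpleFunc.approxOn F' hsm.measurable (range F' ∪ {0}) 0 (by simp) n with hs
  have hsi : Integrable s ν := SimpleFunc.integrable_approxOn_range hsm.measurable hint n
  refine ⟨s, hsi, ?_, fun i => ?_⟩
  · have h1 : ∫ x, ‖s x - F x‖ ∂ν = ∫ x, ‖s x - F' x‖ ∂ν := by
      refine integral_congr_ae ?_
      filter_upwards [hFF'] with x hx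
      rw [hx]
    have h2 := integral_norm_eq_lintegral_enorm (hsi.sub hint).1
    simp only [Pi.sub_apply] at h2
    rw [h1, h2]
    exact ENNReal.toReal_le_of_le_ofReal hε.le hn.le
  · filter_upwards [hinv' i] with x hx
    simp only [hs, SimpleFunc.approxOn, SimpleFunc.coe_comp, Function.comp_apply, hx]

theorem Lp.coeFn_finsetSum {κ : Type*} (t : Finset κ) (f : κ → Lp E 1 ν) :
    (∑ i ∈ t, f i : Lp E 1 ν) =ᵐ[ν] fun x => ∑ i ∈ t, f i x := by
  classical
  induction t using Finset.induction_on with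
  | empty => simpa using! Lp.coeFn_zero E 1 ν
  | insert a t ha ih =>
    rw [Finset.sum_insert ha]
    filter_upwards [Lp.coeFn_add (f a) (∑ i ∈ t, f i), ih] with x h1 h2
    rw [h1, Pi.add_apply, h2, Finset.sum_insert ha]

end InvariantFunctions

/-! ### Functions with values on a line, and sums over level sets -/

section SmulLp

variable {X : Type*} [MeasurableSpace X] {ν : Measure X}
  {E : Type*} [NormedAddCommGroup E] [NormedSpace ℂ E]

/-- The function `x ↦ f x • e` in `L¹(ν; E)`, for `f` in `L¹(ν)` and `e` in `E`, as a bilinear map. -/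
def smulLp : Lp ℂ 1 ν →ₗ[ℂ] E →ₗ[ℂ] Lp E 1 ν :=
  LinearMap.mk₂ ℂ (fun f e => (ContinuousLinearMap.toSpanSingleton ℂ e).compLp f)
    (fun f g e => (ContinuousLinearMap.toSpanSingleton ℂ e).compLpₗ 1 ν |>.map_add f g)
    (fun c f e => (ContinuousLinearMap.toSpanSingleton ℂ e).compLpₗ 1 ν |>.map_smul c f)
    (fun f e e' => by
      rw [← ContinuousLinearMap.add_compLp]
      congr 1
      ext
      simp)
    (fun c f e => by
      rw [← ContinuousLinearMap.smul_compLp]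
      congr 1
      ext
      simp)

theorem coeFn_smulLp (f : Lp ℂ 1 ν) (e : E) : smulLp f e =ᵐ[ν] fun x => f x • e :=
  (ContinuousLinearMap.coeFn_compLp _ f).trans (by simp)

theorem norm_smulLp (f : Lp ℂ 1 ν) (e : E) : ‖smulLp f e‖ = ‖f‖ * ‖e‖ := by
  rw [L1.norm_eq_integral_norm, L1.norm_eq_integral_norm, ← integral_mul_const]
  refine integral_congr_ae ?_
  filter_upwards [coeFn_smulLp f e] with x hx
  rw [hx, norm_smul]

/-- An integrable simple function, composed with `g`, as a sum of terms `1_A • g c` over its level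
sets `A = s⁻¹{c}`. -/
theorem coeFn_sum_smulLp_level {W : Type*} [NormedAddCommGroup W] [DecidableEq W]
    (s : SimpleFunc X W) {α : W → Lp ℂ 1 ν}
    (hα : ∀ c, c ≠ 0 → α c =ᵐ[ν] (s ⁻¹' {c}).indicator fun _ => 1) (g : W → E) (hg : g 0 = 0) :
    (∑ c ∈ s.range.erase 0, smulLp (α c) (g c) : Lp E 1 ν) =ᵐ[ν] fun x => g (s x) := by
  have h1 : ∀ᵐ x ∂ν, ∀ c ∈ s.range.erase 0,
      smulLp (α c) (g c) x = (s ⁻¹' {c}).indicator (fun _ => (1 : ℂ)) x • g c := by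
    refine (Finset.eventually_all _).2 fun c hc => ?_
    filter_upwards [hα c (Finset.ne_of_mem_erase hc), coeFn_smulLp (α c) (g c)] with x h1 h2
    rw [h2, h1]
  filter_upwards [h1, Lp.coeFn_finsetSum (s.range.erase 0) fun c => smulLp (α c) (g c)]
    with x h1 h2
  rw [h2, Finset.sum_congr rfl h1]
  rcases eq_or_ne (s x) 0 with h0 | h0
  · rw [h0, hg]
    refine Finset.sum_eq_zero fun c hc => ?_
    rw [indicator_of_notMem, zero_smul]
    intro h
    exact Finset.ne_of_mem_erase hc (h.symm.trans h0)
  · rw [Finset.sum_eq_single (s x)]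
    · simp
    · intro c _ hc
      rw [indicator_of_notMem, zero_smul]
      exact fun h => hc h.symm
    · intro h
      exact absurd (Finset.mem_erase.2 ⟨h0, s.mem_range_self x⟩) h

/-- As the level sets are disjoint, the norm of the sum in `coeFn_sum_smulLp_level` is the sum of the
norms. -/
theorem norm_sum_smulLp_level {W : Type*} [NormedAddCommGroup W] [DecidableEq W]
    (s : SimpleFunc X W) (hs : Integrable s ν) {α : W → Lp ℂ 1 ν}
    (hα : ∀ c, c ≠ 0 → α c =ᵐ[ν] (s ⁻¹' {c}).indicator fun _ => 1) (g : W → E) (hg : g 0 = 0) :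
    ‖(∑ c ∈ s.range.erase 0, smulLp (α c) (g c) : Lp E 1 ν)‖ =
      ∑ c ∈ s.range.erase 0, ‖α c‖ * ‖g c‖ := by
  have h1 : ‖(∑ c ∈ s.range.erase 0, smulLp (α c) (g c) : Lp E 1 ν)‖ =
      ∫ x, (s.map fun c => ‖g c‖) x ∂ν := by
    rw [L1.norm_eq_integral_norm]
    refine integral_congr_ae ?_
    filter_upwards [coeFn_sum_smulLp_level s hα g hg] with x hx
    rw [hx]
    rfl
  have hsi : Integrable (s.map fun c => ‖g c‖) ν := by
    rw [SimpleFunc.integrable_iff_finMeasSupp] at hs ⊢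
    exact hs.map (by simp [hg])
  rw [h1, SimpleFunc.integral_eq_integral _ hsi |>.symm,
    SimpleFunc.map_integral _ _ hs (by simp [hg])]
  rw [← Finset.sum_erase s.range (a := 0) (by simp [hg])]
  refine Finset.sum_congr rfl fun c hc => ?_
  have h0 := Finset.ne_of_mem_erase hc
  rw [smul_eq_mul]
  congr 1
  rw [L1.norm_eq_integral_norm, ← integral_indicator_one (s.measurableSet_fiber c)]
  refine integral_congr_ae ?_
  filter_upwards [hα c h0] with x hx
  rw [hx]
  by_cases h : x ∈ s ⁻¹' {c} <;> simp [h]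

theorem continuous_smulLp {X : Type*} [MeasurableSpace X] {ν : Measure X}
    {E : Type*} [NormedAddCommGroup E] [NormedSpace ℂ E] :
    Continuous fun p : Lp ℂ 1 ν × E => smulLp p.1 p.2 :=
  ((smulLp (ν := ν) (E := E)).mkContinuous₂ 1
    fun f e => by rw [norm_smulLp, one_mul]).continuous₂

end SmulLp

/-! ### The projective norm on tensors of invariant functions -/

section TensorIsometry

variable {X ι : Type*} [MeasurableSpace X] {ν : Measure X} {γ : ι → X → X}
  {E : Type*} [NormedAddCommGroup E] [NormedSpace ℂ E]
  {A : Type*} [NormedAddCommGroup A] [NormedSpace ℂ A]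

theorem pureSum_singleton (a : A) (e : E) : pureSum [(a, e)] = (a ⊗ₜ[ℂ] e : A ⊗[ℂ] E) :=
  add_zero _

/-- The elementary tensors of `AlgTensor A E`, as a bilinear map. -/
def AlgTensor.mk : A →ₗ[ℂ] E →ₗ[ℂ] AlgTensor A E := TensorProduct.mk ℂ A E

theorem AlgTensor.mk_apply (a : A) (e : E) : AlgTensor.mk a e = pureSum [(a, e)] :=
  (pureSum_singleton a e).symm

theorem AlgTensor.norm_mk_le (a : A) (e : E) : ‖AlgTensor.mk a e‖ ≤ ‖a‖ * ‖e‖ := by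
  rw [AlgTensor.mk_apply]
  simpa [pureCost] using norm_le_pureCost [(a, e)]

theorem AlgTensor.exists_sum (t : AlgTensor A E) :
    ∃ (n : ℕ) (a : Fin n → A) (e : Fin n → E), t = ∑ i, AlgTensor.mk (a i) (e i) := by
  obtain ⟨l, rfl⟩ := exists_pureSum t
  refine ⟨l.length, fun i => (l.get i).1, fun i => (l.get i).2, ?_⟩
  induction l with
  | nil => rfl
  | cons p l ih =>
    rw [pureSum_cons, ih]
    exact (Fin.sum_univ_succ (n := l.length)
      fun i => AlgTensor.mk ((p :: l).get i).1 ((p :: l).get i).2).symm ▸ by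
        rw [AlgTensor.mk_apply]; rfl

/-- The linear map out of the algebraic tensor product given by a bilinear map. -/
def AlgTensor.lift {V : Type*} [AddCommGroup V] [Module ℂ V] (b : A →ₗ[ℂ] E →ₗ[ℂ] V) :
    AlgTensor A E →ₗ[ℂ] V := TensorProduct.lift b

theorem AlgTensor.lift_mk {V : Type*} [AddCommGroup V] [Module ℂ V] (b : A →ₗ[ℂ] E →ₗ[ℂ] V)
    (a : A) (e : E) : AlgTensor.lift b (AlgTensor.mk a e) = b a e := TensorProduct.lift.tmul a e

theorem AlgTensor.norm_lift_le {V : Type*} [NormedAddCommGroup V] [NormedSpace ℂ V]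
    {b : A →ₗ[ℂ] E →ₗ[ℂ] V} (hb : ∀ a e, ‖b a e‖ ≤ ‖a‖ * ‖e‖) (t : AlgTensor A E) :
    ‖AlgTensor.lift b t‖ ≤ ‖t‖ := by
  refine le_norm fun l hl => ?_
  subst hl
  induction l with
  | nil => simp [pureSum_nil, pureCost]
  | cons p l ih =>
    rw [pureSum_cons, map_add, ← AlgTensor.mk_apply, AlgTensor.lift_mk]
    refine (norm_add_le _ _).trans ((add_le_add (hb _ _) ih).trans_eq ?_)
    simp [pureCost]

variable (j : A →ₗᵢ[ℂ] Lp ℂ 1 ν)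

/-- The map `A ⊗ E → L¹(ν; E)`, `a ⊗ e ↦ (x ↦ j a x • e)`, for an embedding `j` of `A` into `L¹(ν)`. -/
def tensorToLp : AlgTensor A E →ₗ[ℂ] Lp E 1 ν := AlgTensor.lift (smulLp.comp j.toLinearMap)

theorem tensorToLp_mk (a : A) (e : E) : tensorToLp j (AlgTensor.mk a e) = smulLp (j a) e :=
  AlgTensor.lift_mk _ a e

variable {j}

/-- The level sets of an invariant simple function are invariant, hence their indicators come from `A`
if the embedding `j : A → L¹(ν)` hits all invariant functions. The level `c = 0` is left out since its measure may be
infinite. -/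
theorem exists_level_preimage
    (hj : ∀ f : Lp ℂ 1 ν, (∀ i, (fun x => f (γ i x)) =ᵐ[ν] f) → f ∈ range j)
    (hγ : ∀ i, Measure.QuasiMeasurePreserving (γ i) ν ν)
    {W : Type*} [NormedAddCommGroup W] (s : SimpleFunc X W) (hs : Integrable s ν)
    (hinv : ∀ i, (fun x => s (γ i x)) =ᵐ[ν] s) :
    ∃ α : W → A, ∀ c, c ≠ 0 → j (α c) =ᵐ[ν] (s ⁻¹' {c}).indicator fun _ => 1 := by
  suffices h : ∀ c : W, ∃ a : A, c ≠ 0 → j a =ᵐ[ν] (s ⁻¹' {c}).indicator fun _ => 1 from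
    ⟨fun c => (h c).choose, fun c => (h c).choose_spec⟩
  intro c
  by_cases hc : c = 0
  · exact ⟨0, fun h => absurd hc h⟩
  have hfin : ν (s ⁻¹' {c}) ≠ ∞ := (SimpleFunc.integrable_iff.1 hs c hc).ne
  have hae : (indicatorConstLp 1 (s.measurableSet_fiber c) hfin (1 : ℂ) : Lp ℂ 1 ν) =ᵐ[ν]
    (s ⁻¹' {c}).indicator fun _ => 1 := indicatorConstLp_coeFn
  obtain ⟨a, ha⟩ := hj (indicatorConstLp 1 (s.measurableSet_fiber c) hfin (1 : ℂ)) fun i => by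
    filter_upwards [hinv i, hae, (hγ i).ae hae] with x h1 h2 h3
    rw [h2, h3]
    have hmem : γ i x ∈ s ⁻¹' {c} ↔ x ∈ s ⁻¹' {c} := by rw [mem_preimage, h1]; rfl
    by_cases h : x ∈ s ⁻¹' {c}
    · rw [indicator_of_mem h, indicator_of_mem (hmem.2 h)]
    · rw [indicator_of_notMem h, indicator_of_notMem (mt hmem.1 h)]
  exact ⟨a, fun _ => ha ▸ hae⟩

/-- The map `A ⊗ E → L¹(ν; E)` is isometric for the projective norm if `A` is the space of invariant
functions in `L¹(ν)`. For a tensor `∑ 1_{A_c} ⊗ e_c` with disjoint sets `A_c` both norms are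
`∑ ν(A_c) ‖e_c‖`, and such tensors approximate every tensor in the projective norm. -/
theorem norm_tensorToLp
    (hj : ∀ f : Lp ℂ 1 ν, f ∈ range j ↔ ∀ i, (fun x => f (γ i x)) =ᵐ[ν] f)
    (hγ : ∀ i, Measure.QuasiMeasurePreserving (γ i) ν ν) (t : AlgTensor A E) :
    ‖tensorToLp j t‖ = ‖t‖ := by
  classical
  have hle : ∀ t : AlgTensor A E, ‖tensorToLp j t‖ ≤ ‖t‖ :=
    AlgTensor.norm_lift_le fun a e => by
      simp [norm_smulLp]
  refine le_antisymm (hle t) ?_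
  obtain ⟨n, a, e, rfl⟩ := t.exists_sum
  set t : AlgTensor A E := ∑ i, AlgTensor.mk (a i) (e i) with ht
  set C : ℝ := ∑ i, ‖e i‖ with hC
  have hC0 : 0 ≤ C := Finset.sum_nonneg fun i _ => norm_nonneg _
  refine le_of_forall_pos_le_add fun ε hε => ?_
  -- a simultaneous approximation of all `a i`, with common level sets, by that of a vector function
  have hFi : Integrable (fun x i => j (a i) x : X → Fin n → ℂ) ν :=
    Integrable.of_eval fun i => L1.integrable_coeFn (j (a i))
  obtain ⟨s, hsi, hs, hsinv⟩ := exists_simpleFunc_invariant hγ hFi (fun i => by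
    have : ∀ᵐ x ∂ν, ∀ k, j (a k) (γ i x) = j (a k) x :=
      ae_all_iff.2 fun k => (hj _).1 ⟨_, rfl⟩ i
    filter_upwards [this] with x hx
    exact funext hx) (ε := ε / (2 * (C + 1))) (by positivity)
  obtain ⟨α, hα⟩ := exists_level_preimage (fun f => (hj f).2) hγ s hsi hsinv
  set b : Fin n → A := fun i => ∑ c ∈ s.range.erase 0, c i • α c with hb
  set t' : AlgTensor A E := ∑ i, AlgTensor.mk (b i) (e i) with ht'
  have hab : ∀ i, ‖a i - b i‖ ≤ ε / (2 * (C + 1)) := fun i => by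
    have h1 : (j (b i) : X → ℂ) =ᵐ[ν] fun x => s x i := by
      have h2 : j (b i) = ∑ c ∈ s.range.erase 0, smulLp (j (α c)) (c i) := by
        rw [hb, map_sum]
        refine Finset.sum_congr rfl fun c _ => ?_
        rw [map_smul]
        refine Lp.ext ((Lp.coeFn_smul _ _).trans ?_)
        filter_upwards [coeFn_smulLp (j (α c)) (c i)] with x hx
        rw [hx, Pi.smul_apply, smul_eq_mul, smul_eq_mul, mul_comm]
      rw [h2]
      exact coeFn_sum_smulLp_level s hα (fun c => c i) rfl
    refine le_trans ?_ hs
    rw [← j.norm_map, map_sub, L1.norm_eq_integral_norm]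
    refine integral_mono_ae (L1.integrable_coeFn _).norm (hsi.sub hFi).norm ?_
    filter_upwards [Lp.coeFn_sub (j (a i)) (j (b i)), h1] with x hx h1
    rw [hx, Pi.sub_apply, h1, norm_sub_rev]
    exact norm_le_pi_norm (s x - fun i => j (a i) x) i
  have htt' : ‖t - t'‖ ≤ ε / 2 := by
    have : t - t' = ∑ i, AlgTensor.mk (a i - b i) (e i) := by
      simp [ht, ht', Finset.sum_sub_distrib]
    rw [this]
    calc _ ≤ ∑ i, ‖AlgTensor.mk (a i - b i) (e i)‖ := norm_sum_le _ _
      _ ≤ ∑ i, ε / (2 * (C + 1)) * ‖e i‖ := Finset.sum_le_sum fun i _ =>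
          (AlgTensor.norm_mk_le _ _).trans (mul_le_mul_of_nonneg_right (hab i) (norm_nonneg _))
      _ = ε / (2 * (C + 1)) * C := by rw [← Finset.mul_sum]
      _ ≤ ε / (2 * (C + 1)) * (C + 1) := by gcongr; linarith
      _ = ε / 2 := by field_simp
  have ht'eq : t' = ∑ c ∈ s.range.erase 0, AlgTensor.mk (α c) (∑ i, c i • e i) := by
    simp only [ht', hb, map_sum, LinearMap.sum_apply, map_smul, LinearMap.smul_apply]
    exact Finset.sum_comm
  have ht'norm : ‖t'‖ ≤ ‖tensorToLp j t'‖ := by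
    have h1 : tensorToLp j t' =
        ∑ c ∈ s.range.erase 0, smulLp (j (α c)) (∑ i, c i • e i) := by
      simp only [ht'eq, map_sum (tensorToLp j), tensorToLp_mk]
    rw [h1, norm_sum_smulLp_level s hsi hα (fun c => ∑ i, c i • e i) (by simp), ht'eq]
    refine (norm_sum_le _ _).trans (Finset.sum_le_sum fun c _ => ?_)
    rw [j.norm_map]
    exact AlgTensor.norm_mk_le _ _
  have h1 : ‖t‖ ≤ ‖t - t'‖ + ‖t'‖ := by simpa using norm_add_le (t - t') t'
  have h2 : ‖tensorToLp j t'‖ ≤ ‖tensorToLp j t‖ + ‖t - t'‖ := by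
    have h3 := norm_sub_le (tensorToLp j t) (tensorToLp j (t - t'))
    rw [← map_sub, sub_sub_cancel] at h3
    exact h3.trans (by gcongr; exact hle _)
  linarith

/-- The image of `A ⊗ E` is dense in the invariant functions of `L¹(ν; E)`. -/
theorem exists_tensorToLp_approx
    (hj : ∀ f : Lp ℂ 1 ν, (∀ i, (fun x => f (γ i x)) =ᵐ[ν] f) → f ∈ range j)
    (hγ : ∀ i, Measure.QuasiMeasurePreserving (γ i) ν ν)
    (F : Lp E 1 ν) (hF : ∀ i, (fun x => F (γ i x)) =ᵐ[ν] F) {ε : ℝ} (hε : 0 < ε) :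
    ∃ t : AlgTensor A E, ‖tensorToLp j t - F‖ ≤ ε := by
  classical
  obtain ⟨s, hsi, hs, hsinv⟩ := exists_simpleFunc_invariant hγ (L1.integrable_coeFn F) hF hε
  obtain ⟨α, hα⟩ := exists_level_preimage hj hγ s hsi hsinv
  refine ⟨∑ c ∈ s.range.erase 0, AlgTensor.mk (α c) c, le_trans (le_of_eq ?_) hs⟩
  simp only [map_sum (tensorToLp j), tensorToLp_mk]
  rw [L1.norm_eq_integral_norm]
  refine integral_congr_ae ?_
  filter_upwards [Lp.coeFn_sub (∑ c ∈ s.range.erase 0, smulLp (j (α c)) c) F,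
    coeFn_sum_smulLp_level s hα id rfl] with x h1 h2
  simp only [id] at h2
  rw [h1, Pi.sub_apply, h2]

/-- A norm preserving linear map with dense range from the algebraic tensor product to a Banach space
extends to an isomorphism of the projective tensor product. -/
theorem ProjTensor.exists_linearIsometryEquiv {A B Z : Type*} [NormedAddCommGroup A]
    [NormedSpace ℂ A] [NormedAddCommGroup B] [NormedSpace ℂ B] [NormedAddCommGroup Z]
    [NormedSpace ℂ Z] [CompleteSpace Z] (U : AlgTensor A B →ₗ[ℂ] Z) (hU : ∀ t, ‖U t‖ = ‖t‖)
    (hd : DenseRange U) :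
    ∃ Ψ : ProjTensor A B ≃ₗᵢ[ℂ] Z, ∀ t, Ψ (ProjTensor.of A B t) = U t := by
  have hof : DenseRange (ProjTensor.of A B).toLinearMap := ProjTensor.isDenseInducing_of.dense
  have heq : ∀ t, U.extendOfNorm (ProjTensor.of A B).toLinearMap (ProjTensor.of A B t) = U t :=
    LinearMap.extendOfNorm_eq hof ⟨1, fun t => by
      rw [one_mul, hU]; exact (ProjTensor.norm_of t).ge⟩
  let Φ : ProjTensor A B →ₗᵢ[ℂ] Z :=
    { (U.extendOfNorm (ProjTensor.of A B).toLinearMap).toLinearMap with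
      norm_map' := ProjTensor.induction₁
        (isClosed_eq (U.extendOfNorm (ProjTensor.of A B).toLinearMap).continuous.norm
          continuous_norm) fun t => by
        refine Eq.trans ?_ ((hU t).trans (ProjTensor.norm_of t).symm)
        exact congrArg norm (heq t) }
  have hΦ : ∀ t, Φ (ProjTensor.of A B t) = U t := heq
  have hsurj : Function.Surjective Φ := by
    have hcl : IsClosed (range Φ) := Φ.isometry.isClosedEmbedding.isClosed_range
    intro z
    have hz : z ∈ closure (range Φ) := closure_mono (by
      rintro _ ⟨t, rfl⟩
      exact ⟨_, hΦ t⟩) (hd z)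
    rwa [hcl.closure_eq] at hz
  exact ⟨LinearIsometryEquiv.ofSurjective Φ hsurj, hΦ⟩

end TensorIsometry

/-! ### Vector-valued functions with values in a closed subspace -/

section ClosedSubspace

/-- An integrable function all of whose integrals lie in a closed subspace has almost all its values
in that subspace. -/
theorem ae_mem_of_forall_setIntegral_mem {X : Type*} [MeasurableSpace X] {ν : Measure X}
    {E : Type*} [NormedAddCommGroup E] [NormedSpace ℂ E] [CompleteSpace E] {M : Submodule ℂ E}
    (hM : IsClosed (M : Set E)) {F : X → E} (hF : Integrable F ν)
    (h : ∀ s, MeasurableSet s → ∫ x in s, F x ∂ν ∈ M) : ∀ᵐ x ∂ν, F x ∈ M := by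
  -- the quotient norm on `E / M` is found by instance resolution
  have := hM
  let q : E →L[ℂ] E ⧸ M := M.mkQL
  have h1 : (fun x => q (F x)) =ᵐ[ν] 0 := by
    refine (q.integrable_comp hF).ae_eq_zero_of_forall_setIntegral_eq_zero fun s hs _ => ?_
    rw [q.integral_comp_comm hF.integrableOn]
    exact (Submodule.Quotient.mk_eq_zero M).2 (h s hs)
  filter_upwards [h1] with x hx
  exact (Submodule.Quotient.mk_eq_zero M).1 hx

/-- An element of `L¹(ν; E)` with values in the range of an
isometric embedding `i : E' → E` comes from `L¹(ν; E')`. -/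
theorem exists_compLp_eq {X : Type*} [MeasurableSpace X] {ν : Measure X}
    {E E' : Type*} [NormedAddCommGroup E] [NormedSpace ℂ E] [NormedAddCommGroup E']
    [NormedSpace ℂ E'] (i : E' →ₗᵢ[ℂ] E) (F : Lp E 1 ν) (h : ∀ᵐ x ∂ν, F x ∈ range i) :
    ∃ F' : Lp E' 1 ν, i.toContinuousLinearMap.compLp F' = F := by
  classical
  let F₀ : X → E' := fun x => if hx : F x ∈ range i then hx.choose else 0
  have hF₀ : (fun x => i (F₀ x)) =ᵐ[ν] F := by
    filter_upwards [h] with x hx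
    simp only [F₀, dif_pos hx]
    exact hx.choose_spec
  have hm : AEStronglyMeasurable F₀ ν :=
    i.isometry.isEmbedding.aestronglyMeasurable_comp_iff.1
      ((Lp.aestronglyMeasurable F).congr hF₀.symm)
  have hmem : MemLp F₀ 1 ν := (Lp.memLp F).of_le hm (by
    filter_upwards [hF₀] with x hx
    rw [← hx, i.norm_map])
  refine ⟨hmem.toLp F₀, Lp.ext ?_⟩
  filter_upwards [i.toContinuousLinearMap.coeFn_compLp (hmem.toLp F₀), hmem.coeFn_toLp, hF₀]
    with x h1 h2 h3
  rw [h1, h2, ← h3]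
  rfl

theorem norm_compLpL_isometry {X : Type*} [MeasurableSpace X] {ν : Measure X}
    {E E' : Type*} [NormedAddCommGroup E] [NormedSpace ℂ E] [NormedAddCommGroup E']
    [NormedSpace ℂ E'] (i : E' →ₗᵢ[ℂ] E) (F : Lp E' 1 ν) :
    ‖i.toContinuousLinearMap.compLpL 1 ν F‖ = ‖F‖ := by
  rw [L1.norm_eq_integral_norm, L1.norm_eq_integral_norm]
  refine integral_congr_ae ?_
  filter_upwards [i.toContinuousLinearMap.coeFn_compLpL (p := 1) F] with x hx
  rw [hx]
  exact i.norm_map _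

end ClosedSubspace

attribute [local instance 10] borelMeasurableSpace borelSpace

/-! ### Haar measure of a product of two groups -/

section HaarProduct

/-- Here `G` has its Borel σ-algebra and `G₁ × G₂` the product σ-algebra. -/
theorem measurable_equiv_prod {G₁ G₂ G : Type*} [Group G₁] [TopologicalSpace G₁] [Group G₂]
    [TopologicalSpace G₂] [Group G] [TopologicalSpace G] (e : G ≃ₜ* G₁ × G₂) : Measurable e :=
  ((continuous_fst.comp e.continuous).measurable).prodMk
    ((continuous_snd.comp e.continuous).measurable)

variable {G₁ : Type*} [Group G₁] [TopologicalSpace G₁] [IsTopologicalGroup G₁]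
  [LocallyCompactSpace G₁]
  {G₂ : Type*} [Group G₂] [TopologicalSpace G₂]
  {G : Type*} [Group G] [TopologicalSpace G] [IsTopologicalGroup G] [LocallyCompactSpace G]

/-- The Haar measure of `A × B` in `G ≃ G₁ × G₂` is proportional to that of `A`, since `A × B` for fixed
`B` defines a left invariant measure on `G₁`. -/
theorem haar_cylinder [T2Space G₁] (e : G ≃ₜ* G₁ × G₂) {B : Set G₂}
    (hBc : IsCompact (closure B)) {K A : Set G₁} (hKc : IsCompact (closure K))
    (hAc : IsCompact (closure A)) (hK : MeasurableSet K) (hA : MeasurableSet A) :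
    (Measure.haar : Measure G) {z | (e z).1 ∈ A ∧ (e z).2 ∈ B} * (Measure.haar : Measure G₁) K =
      (Measure.haar : Measure G) {z | (e z).1 ∈ K ∧ (e z).2 ∈ B} * (Measure.haar : Measure G₁) A := by
  have hm1 : Measurable fun z : G => (e z).1 := (continuous_fst.comp e.continuous).measurable
  have hm2 : Measurable fun z : G => (e z).2 := (continuous_snd.comp e.continuous).measurable
  set ρ : Measure G₁ := ((Measure.haar : Measure G).restrict {z | (e z).2 ∈ B}).map
    (fun z => (e z).1) with hρ
  have happ : ∀ {S : Set G₁}, MeasurableSet S →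
      ρ S = (Measure.haar : Measure G) {z | (e z).1 ∈ S ∧ (e z).2 ∈ B} := fun {S} hS => by
    rw [hρ, Measure.map_apply hm1 hS, Measure.restrict_apply (hm1 hS)]
    rfl
  have : IsFiniteMeasureOnCompacts ρ := ⟨fun S hS => by
    rw [happ hS.isClosed.measurableSet]
    refine (measure_mono ?_).trans_lt
      (e.toHomeomorph.isCompact_preimage.2 (hS.prod hBc)).measure_lt_top
    exact fun z hz => ⟨hz.1, subset_closure hz.2⟩⟩
  -- left translation by `g` on the base lifts to left translation by `e.symm (g, 1)`
  have : ρ.IsMulLeftInvariant := ⟨fun g => by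
    refine Measure.ext fun S hS => ?_
    have hS' : MeasurableSet ((fun x => g * x) ⁻¹' S) := measurable_const_mul g hS
    rw [Measure.map_apply (measurable_const_mul g) hS, happ hS', happ hS,
      ← measure_preimage_mul (Measure.haar : Measure G) (e.symm (g⁻¹, 1))]
    congr 1
    ext z
    simp⟩
  have h1 := Measure.measure_isMulInvariant_eq_smul_of_isCompact_closure ρ
    (Measure.haar : Measure G₁) hAc
  have h2 := Measure.measure_isMulInvariant_eq_smul_of_isCompact_closure ρ
    (Measure.haar : Measure G₁) hKc
  rw [← happ hA, ← happ hK, h1, h2]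
  simp only [ENNReal.smul_def, smul_eq_mul]
  ring

variable [IsTopologicalGroup G₂] [LocallyCompactSpace G₂]

/-- Haar measure of `G ≃ G₁ × G₂` is a constant multiple of the product of the Haar measures on
rectangles with compact closure. -/
theorem exists_haar_rectangle [T2Space G₁] [T2Space G₂] (e : G ≃ₜ* G₁ × G₂) :
    ∃ κ : ℝ≥0, 0 < κ ∧ ∀ (A : Set G₁) (B : Set G₂), MeasurableSet A → MeasurableSet B →
      IsCompact (closure A) → IsCompact (closure B) →
      (Measure.haar : Measure G) {z | (e z).1 ∈ A ∧ (e z).2 ∈ B} =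
        κ * ((Measure.haar : Measure G₁) A * (Measure.haar : Measure G₂) B) := by
  obtain ⟨K⟩ : Nonempty (TopologicalSpace.PositiveCompacts G₁) := inferInstance
  obtain ⟨L⟩ : Nonempty (TopologicalSpace.PositiveCompacts G₂) := inferInstance
  have hKc : IsCompact (closure (K : Set G₁)) := K.isCompact.closure
  have hLc : IsCompact (closure (L : Set G₂)) := L.isCompact.closure
  have hKm : MeasurableSet (K : Set G₁) := K.isCompact.isClosed.measurableSet
  have hLm : MeasurableSet (L : Set G₂) := L.isCompact.isClosed.measurableSet
  set a := (Measure.haar : Measure G₁) K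
  set b := (Measure.haar : Measure G₂) L
  have ha0 : a ≠ 0 := (Measure.measure_pos_of_nonempty_interior _ K.interior_nonempty).ne'
  have hb0 : b ≠ 0 := (Measure.measure_pos_of_nonempty_interior _ L.interior_nonempty).ne'
  have ha : a ≠ ∞ := K.isCompact.measure_lt_top.ne
  have hb : b ≠ ∞ := L.isCompact.measure_lt_top.ne
  set m := (Measure.haar : Measure G) {z | (e z).1 ∈ (K : Set G₁) ∧ (e z).2 ∈ (L : Set G₂)} with hm
  have hmtop : m ≠ ∞ :=
    (e.toHomeomorph.isCompact_preimage.2 (K.isCompact.prod L.isCompact)).measure_lt_top.ne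
  have hm0 : m ≠ 0 := by
    refine (Measure.measure_pos_of_nonempty_interior _ ?_).ne'
    obtain ⟨x, hx⟩ := K.interior_nonempty
    obtain ⟨y, hy⟩ := L.interior_nonempty
    refine ⟨e.symm (x, y), interior_maximal (t := e ⁻¹' (interior K ×ˢ interior L)) ?_
      ((isOpen_interior.prod isOpen_interior).preimage e.continuous) ?_⟩
    · exact fun z hz => ⟨interior_subset hz.1, interior_subset hz.2⟩
    · simp [hx, hy]
  have hab0 : a * b ≠ 0 := mul_ne_zero ha0 hb0
  have habt : a * b ≠ ∞ := ENNReal.mul_ne_top ha hb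
  have hdiv : m / (a * b) ≠ ∞ := ENNReal.div_ne_top hmtop hab0
  refine ⟨(m / (a * b)).toNNReal, ENNReal.toNNReal_pos (ENNReal.div_pos hm0 habt).ne' hdiv,
    fun A B hA hB hAc hBc => ?_⟩
  rw [ENNReal.coe_toNNReal hdiv]
  have h1 := haar_cylinder e hBc hKc hAc hKm hA
  let e' : G ≃ₜ* G₂ × G₁ :=
    { e.toMulEquiv.trans MulEquiv.prodComm with
      continuous_toFun := continuous_swap.comp e.continuous
      continuous_invFun := e.symm.continuous.comp continuous_swap }
  have h2 : _ = (Measure.haar : Measure G) {z | (e z).2 ∈ (L : Set G₂) ∧ (e z).1 ∈ (K : Set G₁)} * _ :=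
    haar_cylinder e' hKc hLc hBc hLm hB
  have h3 : (Measure.haar : Measure G) {z | (e' z).1 ∈ B ∧ (e' z).2 ∈ (K : Set G₁)} =
      (Measure.haar : Measure G) {z | (e z).1 ∈ (K : Set G₁) ∧ (e z).2 ∈ B} := by
    congr 1
    ext z
    exact and_comm
  have h4 : {z | (e z).2 ∈ (L : Set G₂) ∧ (e z).1 ∈ (K : Set G₁)} =
      {z | (e z).1 ∈ (K : Set G₁) ∧ (e z).2 ∈ (L : Set G₂)} := by
    ext z
    exact and_comm
  rw [h3, h4, ← hm] at h2
  rw [← ENNReal.mul_left_inj hab0 habt]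
  calc _ = ((Measure.haar : Measure G) {z | (e z).1 ∈ A ∧ (e z).2 ∈ B} * a) * b := by ring
    _ = ((Measure.haar : Measure G) {z | (e z).1 ∈ (K : Set G₁) ∧ (e z).2 ∈ B} * b) *
        (Measure.haar : Measure G₁) A := by rw [h1]; ring
    _ = (m / (a * b) * (a * b)) *
        ((Measure.haar : Measure G₁) A * (Measure.haar : Measure G₂) B) := by
      rw [h2, ENNReal.div_mul_cancel hab0 habt]; ring
    _ = _ := by ring

/-- The constant `κ` relates Haar measure of `G ≃ G₁ × G₂` to the product of the Haar measures of the
factors: on a compact rectangle, and for the product σ-algebra, the former is `κ` times the latter. -/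
def IsHaarRatio (e : G ≃ₜ* G₁ × G₂) (κ : ℝ≥0) : Prop :=
  ∀ (K : Set G₁) (L : Set G₂), IsCompact K → IsCompact L →
    ((Measure.haar : Measure G).restrict {z | (e z).1 ∈ K ∧ (e z).2 ∈ L}).map e =
      κ • ((Measure.haar : Measure G₁).restrict K).prod ((Measure.haar : Measure G₂).restrict L)

/-- The σ-algebra on the right hand side of `IsHaarRatio` is the product σ-algebra, for which rectangles
determine a finite measure. -/
theorem exists_isHaarRatio [T2Space G₁] [T2Space G₂] (e : G ≃ₜ* G₁ × G₂) :
    ∃ κ : ℝ≥0, 0 < κ ∧ IsHaarRatio e κ := by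
  obtain ⟨κ, hκ, h⟩ := exists_haar_rectangle e
  refine ⟨κ, hκ, fun K L hK hL => ?_⟩
  have : IsFiniteMeasure ((Measure.haar : Measure G₁).restrict K) :=
    isFiniteMeasure_restrict.2 hK.measure_lt_top.ne
  have : IsFiniteMeasure ((Measure.haar : Measure G₂).restrict L) :=
    isFiniteMeasure_restrict.2 hL.measure_lt_top.ne
  have hprod : κ • ((Measure.haar : Measure G₁).restrict K).prod
      ((Measure.haar : Measure G₂).restrict L) =
      (κ • (Measure.haar : Measure G₁).restrict K).prod ((Measure.haar : Measure G₂).restrict L) :=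
    (Measure.prod_smul_left κ).symm
  rw [hprod]
  refine (Measure.prod_eq fun S T hS hT => ?_).symm
  have hKm := hK.isClosed.measurableSet
  have hLm := hL.isClosed.measurableSet
  rw [Measure.map_apply (measurable_equiv_prod e) (hS.prod hT),
    Measure.restrict_apply (measurable_equiv_prod e (hS.prod hT)), Measure.smul_apply,
    Measure.restrict_apply hS, Measure.restrict_apply hT]
  have := h (S ∩ K) (T ∩ L) (hS.inter hKm) (hT.inter hLm)
    (hK.closure_of_subset inter_subset_right) (hL.closure_of_subset inter_subset_right)
  rw [ENNReal.smul_def, smul_eq_mul, mul_assoc, ← this]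
  congr 1
  ext z
  simp only [mem_inter_iff, mem_preimage, mem_prod, mem_ofPred_eq]
  tauto

theorem IsHaarRatio.lintegral_eq {e : G ≃ₜ* G₁ × G₂} {κ : ℝ≥0} (hκ : IsHaarRatio e κ)
    {K : Set G₁} {L : Set G₂} (hK : IsCompact K) (hL : IsCompact L) {h : G₁ × G₂ → ℝ≥0∞}
    (hm : Measurable h) (h0 : ∀ x y, ¬(x ∈ K ∧ y ∈ L) → h (x, y) = 0) :
    ∫⁻ z, h (e z) ∂(Measure.haar : Measure G) =
      κ * ∫⁻ x, ∫⁻ y, h (x, y) ∂(Measure.haar : Measure G₂) ∂(Measure.haar : Measure G₁) := by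
  have : IsFiniteMeasure ((Measure.haar : Measure G₂).restrict L) :=
    isFiniteMeasure_restrict.2 hL.measure_lt_top.ne
  have h1 : ∫⁻ z, h (e z) ∂(Measure.haar : Measure G) =
      ∫⁻ z in {z | (e z).1 ∈ K ∧ (e z).2 ∈ L}, h (e z) ∂(Measure.haar : Measure G) := by
    refine (setLIntegral_eq_of_support_subset fun z hz => ?_).symm
    by_contra hz'
    exact hz (h0 (e z).1 (e z).2 hz')
  have h2 : ∀ x, ∫⁻ y in L, h (x, y) ∂(Measure.haar : Measure G₂) =
      ∫⁻ y, h (x, y) ∂(Measure.haar : Measure G₂) := fun x =>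
    setLIntegral_eq_of_support_subset fun y hy => by
      by_contra hy'
      exact hy (h0 x y fun hxy => hy' hxy.2)
  rw [h1, ← lintegral_map hm (measurable_equiv_prod e), hκ K L hK hL, lintegral_smul_measure,
    lintegral_prod _ hm.aemeasurable]
  simp_rw [h2]
  rw [ENNReal.smul_def, smul_eq_mul]
  congr 1
  refine setLIntegral_eq_of_support_subset fun x hx => ?_
  by_contra hx'
  refine hx ?_
  show ∫⁻ y, h (x, y) ∂(Measure.haar : Measure G₂) = 0
  simp [fun y => h0 x y fun hxy => hx' hxy.1]

theorem IsHaarRatio.integral_mul {e : G ≃ₜ* G₁ × G₂} {κ : ℝ≥0} (hκ : IsHaarRatio e κ)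
    {K : Set G₁} {L : Set G₂} (hK : IsCompact K) (hL : IsCompact L) {u : G₁ → ℂ} {v : G₂ → ℂ}
    (hu : Measurable u) (hv : Measurable v)
    (hu0 : ∀ x, x ∉ K → u x = 0) (hv0 : ∀ y, y ∉ L → v y = 0) :
    ∫ z, u (e z).1 * v (e z).2 ∂(Measure.haar : Measure G) =
      κ * ((∫ x, u x ∂(Measure.haar : Measure G₁)) * ∫ y, v y ∂(Measure.haar : Measure G₂)) := by
  have : IsFiniteMeasure ((Measure.haar : Measure G₂).restrict L) :=
    isFiniteMeasure_restrict.2 hL.measure_lt_top.ne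
  have : IsFiniteMeasure ((Measure.haar : Measure G₁).restrict K) :=
    isFiniteMeasure_restrict.2 hK.measure_lt_top.ne
  have h1 : ∫ z, u (e z).1 * v (e z).2 ∂(Measure.haar : Measure G) =
      ∫ z in {z | (e z).1 ∈ K ∧ (e z).2 ∈ L}, u (e z).1 * v (e z).2 ∂(Measure.haar : Measure G) := by
    refine (setIntegral_eq_integral_of_forall_compl_eq_zero fun z hz => ?_).symm
    by_cases h : (e z).1 ∈ K
    · rw [hv0 _ fun h' => hz ⟨h, h'⟩, mul_zero]
    · rw [hu0 _ h, zero_mul]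
  have h2 := integral_map (μ := (Measure.haar : Measure G).restrict {z | (e z).1 ∈ K ∧ (e z).2 ∈ L})
    (measurable_equiv_prod e).aemeasurable (f := fun p : G₁ × G₂ => u p.1 * v p.2)
    ((hu.comp measurable_fst).mul (hv.comp measurable_snd)).aestronglyMeasurable
  rw [h1, ← h2, hκ K L hK hL, integral_smul_nnreal_measure, integral_prod_mul,
    setIntegral_eq_integral_of_forall_compl_eq_zero hu0,
    setIntegral_eq_integral_of_forall_compl_eq_zero hv0]
  rfl

end HaarProduct

/-! ### Compactly supported continuous functions in Beurling algebras -/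

section CompactlySupportedFunctions

variable {G : Type*} [Group G] [TopologicalSpace G] [IsTopologicalGroup G]
  [LocallyCompactSpace G] (ω : Weight G)

/-- The class in `L¹(G, ω)` of a compactly supported continuous function. -/
def ccToL1 : C_c(G, ℂ) →ₗ[ℂ] L1 ω where
  toFun k := (memLp_of_compact k.continuous k.hasCompactSupport).toLp k
  map_add' _ _ := rfl
  map_smul' _ _ := rfl

theorem coeFn_ccToL1 (k : C_c(G, ℂ)) : ccToL1 ω k =ᵐ[ω.measure] k :=
  (memLp_of_compact k.continuous k.hasCompactSupport).coeFn_toLp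

theorem denseRange_ccToL1 : DenseRange (ccToL1 ω) := by
  refine Metric.dense_iff.2 fun f ε hε => ?_
  obtain ⟨k, hk, hs, h⟩ := exists_compactSupport_approx f (half_pos hε)
  refine ⟨ccToL1 ω ⟨⟨k, hk⟩, hs⟩, ?_, mem_range_self _⟩
  rw [Metric.mem_ball, dist_comm, dist_eq_norm]
  exact h.trans_lt (half_lt_self hε)

theorem enorm_ccToL1 (k : C_c(G, ℂ)) : ‖ccToL1 ω k‖ₑ =
    ∫⁻ x, ENNReal.ofReal (ω x) * ‖k x‖ₑ ∂(Measure.haar : Measure G) := by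
  rw [L1.enorm_eq]
  have h : ∀ᵐ x ∂(Measure.haar : Measure G), ccToL1 ω k x = k x :=
    ω.ae_measure.1 (coeFn_ccToL1 ω k)
  refine lintegral_congr_ae ?_
  filter_upwards [h] with x hx
  rw [hx]

end CompactlySupportedFunctions

/-! ### Functions on a product as vector-valued functions -/

section Slices

variable {X Y : Type*} [TopologicalSpace X] [TopologicalSpace Y]

/-- The slice `y ↦ k (x, y)`. -/
def slice [R1Space Y] (k : C_c(X × Y, ℂ)) (x : X) : C_c(Y, ℂ) where
  toFun y := k (x, y)
  continuous_toFun := by fun_prop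
  hasCompactSupport' := HasCompactSupport.intro (k.hasCompactSupport.image continuous_snd)
    fun y hy => by
      by_contra h
      exact hy ⟨(x, y), subset_tsupport _ h, rfl⟩

theorem slice_apply [R1Space Y] (k : C_c(X × Y, ℂ)) (x : X) (y : Y) : slice k x y = k (x, y) := rfl

theorem eq_zero_of_notMem_image_fst (k : C_c(X × Y, ℂ)) {x : X}
    (hx : x ∉ Prod.fst '' tsupport k) (y : Y) : k (x, y) = 0 := by
  by_contra h
  exact hx ⟨(x, y), subset_tsupport _ h, rfl⟩

theorem eq_zero_of_notMem_image_snd (k : C_c(X × Y, ℂ)) {y : Y}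
    (hy : y ∉ Prod.snd '' tsupport k) (x : X) : k (x, y) = 0 := by
  by_contra h
  exact hy ⟨(x, y), subset_tsupport _ h, rfl⟩

variable {G₁ : Type*} [Group G₁] [TopologicalSpace G₁] [IsTopologicalGroup G₁]
  [LocallyCompactSpace G₁]
  {G₂ : Type*} [Group G₂] [TopologicalSpace G₂] [IsTopologicalGroup G₂]
  [LocallyCompactSpace G₂]
  (ω₁ : Weight G₁) (ω₂ : Weight G₂)

theorem continuous_slice (k : C_c(X × G₂, ℂ)) :
    Continuous fun x => ccToL1 ω₂ (slice k x) := by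
  rw [continuous_iff_continuousAt]
  intro x₀
  rw [ContinuousAt, tendsto_iff_norm_sub_tendsto_zero]
  have hc : ContinuousOn (fun x => ∫ y, ‖k (x, y) - k (x₀, y)‖ ∂ω₂.measure) univ := by
    refine continuousOn_integral_of_compact_support (k := Prod.snd '' tsupport k)
      (k.hasCompactSupport.image continuous_snd) ?_ ?_
    · refine Continuous.continuousOn ?_
      exact (k.continuous.sub (k.continuous.comp (continuous_const.prodMk continuous_snd))).norm
    · intro x y _ hy
      simp [eq_zero_of_notMem_image_snd k hy]
  have h1 := (hc.continuousAt (x := x₀) univ_mem).tendsto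
  simp only [sub_self, norm_zero, integral_zero] at h1
  refine h1.congr fun x => ?_
  rw [L1.norm_eq_integral_norm, ← map_sub]
  refine integral_congr_ae ?_
  filter_upwards [coeFn_ccToL1 ω₂ (slice k x - slice k x₀)] with y hy
  rw [hy]
  rfl

theorem memLp_slice (k : C_c(G₁ × G₂, ℂ)) :
    MemLp (fun x => ccToL1 ω₂ (slice k x)) 1 ω₁.measure := by
  refine (continuous_slice ω₂ k).memLp_of_hasCompactSupport
    (HasCompactSupport.intro (k.hasCompactSupport.image continuous_fst) fun x hx => ?_)
  have : slice k x = 0 := by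
    ext y
    exact eq_zero_of_notMem_image_fst k hx y
  rw [this, map_zero]

/-- The function `x ↦ k (x, ·)`, as an element of `L¹(G₁, ω₁; L¹(G₂, ω₂))`. -/
def sliceCc : C_c(G₁ × G₂, ℂ) →ₗ[ℂ] Lp (L1 ω₂) 1 ω₁.measure where
  toFun k := (memLp_slice ω₁ ω₂ k).toLp _
  map_add' k k' := by
    rw [← MemLp.toLp_add]
    rfl
  map_smul' c k := by
    rw [RingHom.id_apply, ← MemLp.toLp_const_smul]
    rfl

theorem coeFn_sliceCc (k : C_c(G₁ × G₂, ℂ)) :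
    sliceCc ω₁ ω₂ k =ᵐ[ω₁.measure] fun x => ccToL1 ω₂ (slice k x) :=
  (memLp_slice ω₁ ω₂ k).coeFn_toLp

variable {κ : ℝ≥0}

/-- Fubini's theorem, applicable since a compactly supported continuous function and the weight are
measurable for the product σ-algebra. -/
theorem norm_sliceCc (hκ : IsHaarRatio (ContinuousMulEquiv.refl (G₁ × G₂)) κ)
    (k : C_c(G₁ × G₂, ℂ)) :
    ‖ccToL1 (ω₁.prod ω₂) k‖ = κ * ‖sliceCc ω₁ ω₂ k‖ := by
  have h1 : ‖sliceCc ω₁ ω₂ k‖ₑ = ∫⁻ x, ∫⁻ y, ENNReal.ofReal (ω₁ x * ω₂ y) * ‖k (x, y)‖ₑ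
      ∂(Measure.haar : Measure G₂) ∂(Measure.haar : Measure G₁) := by
    have h2 : ∀ᵐ x ∂(Measure.haar : Measure G₁), sliceCc ω₁ ω₂ k x = ccToL1 ω₂ (slice k x) :=
      ω₁.ae_measure.1 (coeFn_sliceCc ω₁ ω₂ k)
    rw [Lp.enorm_def, eLpNorm_one_eq_lintegral_enorm, ω₁.lintegral_measure]
    refine lintegral_congr_ae ?_
    filter_upwards [h2] with x hx
    rw [hx, enorm_ccToL1, ← lintegral_const_mul' _ _ ENNReal.ofReal_ne_top]
    refine lintegral_congr fun y => ?_
    rw [slice_apply, ENNReal.ofReal_mul (ω₁.pos' x).le, mul_assoc]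
  have h2 : ‖ccToL1 (ω₁.prod ω₂) k‖ₑ = κ * ‖sliceCc ω₁ ω₂ k‖ₑ := by
    rw [enorm_ccToL1, h1]
    refine hκ.lintegral_eq (h := fun p => ENNReal.ofReal (ω₁ p.1 * ω₂ p.2) * ‖k p‖ₑ)
      (k.hasCompactSupport.image continuous_fst) (k.hasCompactSupport.image continuous_snd) ?_ ?_
    · exact ((ω₁.measurable.comp measurable_fst).mul
        (ω₂.measurable.comp measurable_snd)).ennreal_ofReal.mul
        (k.hasCompactSupport.measurable_of_prod k.continuous).enorm
    · intro x y hxy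
      by_cases hx : x ∈ Prod.fst '' tsupport k
      · simp [eq_zero_of_notMem_image_snd k (fun hy => hxy ⟨hx, hy⟩) x]
      · simp [eq_zero_of_notMem_image_fst k hx y]
  rw [← toReal_enorm, h2, ENNReal.toReal_mul, toReal_enorm]
  rfl

/-- The identification `f ↦ (x ↦ f (x, ·))` of `L¹(G₁ × G₂, ω₁ × ω₂)` with `L¹(G₁, ω₁; L¹(G₂, ω₂))`,
defined as the continuous extension from the compactly supported continuous functions. -/
def sliceL : L1 (ω₁.prod ω₂) →L[ℂ] Lp (L1 ω₂) 1 ω₁.measure :=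
  (sliceCc ω₁ ω₂).extendOfNorm (ccToL1 (ω₁.prod ω₂))

theorem sliceL_ccToL1 (hκ : IsHaarRatio (ContinuousMulEquiv.refl (G₁ × G₂)) κ) (hκ0 : 0 < κ)
    (k : C_c(G₁ × G₂, ℂ)) :
    sliceL ω₁ ω₂ (ccToL1 (ω₁.prod ω₂) k) = sliceCc ω₁ ω₂ k := by
  refine LinearMap.extendOfNorm_eq (denseRange_ccToL1 _) ⟨(κ : ℝ)⁻¹, fun k => ?_⟩ k
  rw [norm_sliceCc ω₁ ω₂ hκ, inv_mul_cancel_left₀ (by exact_mod_cast hκ0.ne')]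

theorem norm_eq_mul_norm_sliceL (hκ : IsHaarRatio (ContinuousMulEquiv.refl (G₁ × G₂)) κ)
    (hκ0 : 0 < κ) (u : L1 (ω₁.prod ω₂)) : ‖u‖ = κ * ‖sliceL ω₁ ω₂ u‖ := by
  refine (denseRange_ccToL1 (ω₁.prod ω₂)).induction_on u
    (isClosed_eq (by fun_prop) (by fun_prop)) fun k => ?_
  rw [sliceL_ccToL1 ω₁ ω₂ hκ hκ0, norm_sliceCc ω₁ ω₂ hκ]

end Slices

section SliceEquiv

variable {G₁ : Type*} [Group G₁] [TopologicalSpace G₁] [IsTopologicalGroup G₁]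
  [LocallyCompactSpace G₁]
  {G₂ : Type*} [Group G₂] [TopologicalSpace G₂] [IsTopologicalGroup G₂]
  [LocallyCompactSpace G₂]
  (ω₁ : Weight G₁) (ω₂ : Weight G₂) {κ : ℝ≥0}

/-- The function `(x, y) ↦ φ x * ψ y`. -/
def tensorCc {X Y : Type*} [TopologicalSpace X] [TopologicalSpace Y] [R1Space X] [R1Space Y]
    (φ : C_c(X, ℂ)) (ψ : C_c(Y, ℂ)) : C_c(X × Y, ℂ) where
  toFun p := φ p.1 * ψ p.2
  continuous_toFun := (φ.continuous.comp continuous_fst).mul (ψ.continuous.comp continuous_snd)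
  hasCompactSupport' := HasCompactSupport.intro (φ.hasCompactSupport.prod ψ.hasCompactSupport)
    fun p hp => by
      by_contra h
      exact hp ⟨subset_tsupport _ (left_ne_zero_of_mul h), subset_tsupport _ (right_ne_zero_of_mul h)⟩

theorem sliceL_tensorCc (hκ : IsHaarRatio (ContinuousMulEquiv.refl (G₁ × G₂)) κ) (hκ0 : 0 < κ)
    (φ : C_c(G₁, ℂ)) (ψ : C_c(G₂, ℂ)) :
    sliceL ω₁ ω₂ (ccToL1 (ω₁.prod ω₂) (tensorCc φ ψ)) = smulLp (ccToL1 ω₁ φ) (ccToL1 ω₂ ψ) := by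
  rw [sliceL_ccToL1 ω₁ ω₂ hκ hκ0]
  refine Lp.ext ((coeFn_sliceCc ω₁ ω₂ _).trans ?_)
  filter_upwards [coeFn_smulLp (ccToL1 ω₁ φ) (ccToL1 ω₂ ψ), coeFn_ccToL1 ω₁ φ] with x h1 h2
  rw [h1, h2, ← map_smul]
  rfl

/-- `sliceL` is isometric up to the factor `κ`, so its range is closed; it contains the functions
`x ↦ f x • e`, whose sums are dense. -/
theorem sliceL_bijective (hκ : IsHaarRatio (ContinuousMulEquiv.refl (G₁ × G₂)) κ) (hκ0 : 0 < κ) :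
    Function.Bijective (sliceL ω₁ ω₂) := by
  have hanti : AntilipschitzWith κ (sliceL ω₁ ω₂) :=
    ContinuousLinearMap.antilipschitz_of_bound _ fun u =>
      (norm_eq_mul_norm_sliceL ω₁ ω₂ hκ hκ0 u).le
  refine ⟨hanti.injective, fun F => ?_⟩
  have hclosed : IsClosed (range (sliceL ω₁ ω₂)) :=
    hanti.isClosed_range (sliceL ω₁ ω₂).uniformContinuous
  have h1 : ∀ (f : L1 ω₁) (e : L1 ω₂), smulLp f e ∈ range (sliceL ω₁ ω₂) := fun f e =>
    ((denseRange_ccToL1 ω₁).prodMap (denseRange_ccToL1 ω₂)).induction_on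
      (p := fun q => smulLp q.1 q.2 ∈ range (sliceL ω₁ ω₂)) (f, e)
      (hclosed.preimage continuous_smulLp) fun q =>
        ⟨_, sliceL_tensorCc ω₁ ω₂ hκ hκ0 q.1 q.2⟩
  have h2 : ∀ t : AlgTensor (L1 ω₁) (L1 ω₂),
      tensorToLp LinearIsometry.id t ∈ range (sliceL ω₁ ω₂) := fun t => by
    obtain ⟨n, a, e, rfl⟩ := t.exists_sum
    rw [map_sum]
    exact Submodule.sum_mem (LinearMap.range (sliceL ω₁ ω₂).toLinearMap) fun i _ => by
      rw [tensorToLp_mk]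
      exact h1 _ _
  refine (hclosed.closure_eq ▸ Metric.mem_closure_iff.2 fun ε hε => ?_ : F ∈ range (sliceL ω₁ ω₂))
  obtain ⟨t, ht⟩ := exists_tensorToLp_approx (ι := Empty) (γ := fun i => i.elim)
    (j := LinearIsometry.id (R := ℂ) (E := L1 ω₁)) (fun f _ => ⟨f, rfl⟩) (fun i => i.elim) F
    (fun i => i.elim) (half_pos hε)
  refine ⟨_, h2 t, ?_⟩
  rw [dist_comm, dist_eq_norm]
  exact ht.trans_lt (half_lt_self hε)

/-- The identification of `L¹(G₁ × G₂, ω₁ × ω₂)` with `L¹(G₁, ω₁; L¹(G₂, ω₂))`; it divides norms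
by `κ`. -/
def sliceEquiv (hκ : IsHaarRatio (ContinuousMulEquiv.refl (G₁ × G₂)) κ) (hκ0 : 0 < κ) :
    L1 (ω₁.prod ω₂) ≃ₗ[ℂ] Lp (L1 ω₂) 1 ω₁.measure :=
  LinearEquiv.ofBijective (sliceL ω₁ ω₂).toLinearMap (sliceL_bijective ω₁ ω₂ hκ hκ0)

theorem sliceL_sliceEquiv_symm (hκ : IsHaarRatio (ContinuousMulEquiv.refl (G₁ × G₂)) κ)
    (hκ0 : 0 < κ) (F : Lp (L1 ω₂) 1 ω₁.measure) :
    sliceL ω₁ ω₂ ((sliceEquiv ω₁ ω₂ hκ hκ0).symm F) = F :=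
  (sliceEquiv ω₁ ω₂ hκ hκ0).apply_symm_apply F

theorem norm_sliceEquiv_symm (hκ : IsHaarRatio (ContinuousMulEquiv.refl (G₁ × G₂)) κ)
    (hκ0 : 0 < κ) (F : Lp (L1 ω₂) 1 ω₁.measure) :
    ‖(sliceEquiv ω₁ ω₂ hκ hκ0).symm F‖ = κ * ‖F‖ := by
  rw [norm_eq_mul_norm_sliceL ω₁ ω₂ hκ hκ0, sliceL_sliceEquiv_symm]

/-- The function `(x, y) ↦ f x * g y` in `L¹(G₁ × G₂, ω₁ × ω₂)`, for `f` in `L¹(G₁, ω₁)` and `g` in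
`L¹(G₂, ω₂)`, as a bilinear map. -/
def tensorL1 (hκ : IsHaarRatio (ContinuousMulEquiv.refl (G₁ × G₂)) κ) (hκ0 : 0 < κ) :
    L1 ω₁ →ₗ[ℂ] L1 ω₂ →ₗ[ℂ] L1 (ω₁.prod ω₂) :=
  smulLp.compr₂ (sliceEquiv ω₁ ω₂ hκ hκ0).symm.toLinearMap

theorem tensorL1_apply (hκ : IsHaarRatio (ContinuousMulEquiv.refl (G₁ × G₂)) κ) (hκ0 : 0 < κ)
    (f : L1 ω₁) (g : L1 ω₂) :
    tensorL1 ω₁ ω₂ hκ hκ0 f g = (sliceEquiv ω₁ ω₂ hκ hκ0).symm (smulLp f g) := rfl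

theorem tensorL1_ccToL1 (hκ : IsHaarRatio (ContinuousMulEquiv.refl (G₁ × G₂)) κ) (hκ0 : 0 < κ)
    (φ : C_c(G₁, ℂ)) (ψ : C_c(G₂, ℂ)) :
    tensorL1 ω₁ ω₂ hκ hκ0 (ccToL1 ω₁ φ) (ccToL1 ω₂ ψ) = ccToL1 (ω₁.prod ω₂) (tensorCc φ ψ) := by
  rw [tensorL1_apply, ← sliceL_tensorCc ω₁ ω₂ hκ hκ0]
  exact (sliceEquiv ω₁ ω₂ hκ hκ0).symm_apply_apply _

theorem continuous_tensorL1 (hκ : IsHaarRatio (ContinuousMulEquiv.refl (G₁ × G₂)) κ)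
    (hκ0 : 0 < κ) :
    Continuous fun p : L1 ω₁ × L1 ω₂ => tensorL1 ω₁ ω₂ hκ hκ0 p.1 p.2 :=
  (LinearMap.mkContinuous₂ (tensorL1 ω₁ ω₂ hκ hκ0) κ fun f e => by
    rw [tensorL1_apply, norm_sliceEquiv_symm, norm_smulLp, mul_assoc]).continuous₂

end SliceEquiv

/-! ### Convolution of tensor products -/

section Convolution

variable {G : Type*} [Group G] [TopologicalSpace G] [IsTopologicalGroup G]
  [LocallyCompactSpace G] (ω : Weight G)

/-- The convolution of two compactly supported continuous functions. -/
def convCc (f g : C_c(G, ℂ)) : C_c(G, ℂ) where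
  toFun x := ∫ y, f y * g (y⁻¹ * x) ∂(Measure.haar : Measure G)
  continuous_toFun := by
    rw [← continuousOn_univ]
    refine continuousOn_integral_of_compact_support (k := tsupport f) f.hasCompactSupport ?_ ?_
    · exact ((f.continuous.comp continuous_snd).mul
        (g.continuous.comp (continuous_snd.inv.mul continuous_fst))).continuousOn
    · intro x y _ hy
      simp [image_eq_zero_of_notMem_tsupport hy]
  hasCompactSupport' := by
    refine HasCompactSupport.intro (f.hasCompactSupport.mul g.hasCompactSupport) fun x hx => ?_
    have : ∀ y, f y * g (y⁻¹ * x) = 0 := fun y => by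
      by_contra h
      exact hx ⟨y, subset_tsupport _ (left_ne_zero_of_mul h), y⁻¹ * x,
        subset_tsupport _ (right_ne_zero_of_mul h), mul_inv_cancel_left y x⟩
    simp [this]

theorem ccToL1_mul (f g : C_c(G, ℂ)) : ccToL1 ω f * ccToL1 ω g = ccToL1 ω (convCc f g) := by
  refine Lp.ext ?_
  have h : ∀ᵐ x ∂(Measure.haar : Measure G), (ccToL1 ω f * ccToL1 ω g) x = convCc f g x :=
    L1.mul_ae_eq ω f.continuous f.hasCompactSupport g.continuous g.hasCompactSupport
  have h' : ∀ᵐ x ∂ω.measure, (ccToL1 ω f * ccToL1 ω g) x = convCc f g x := ω.ae_measure.2 h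
  filter_upwards [h', coeFn_ccToL1 ω (convCc f g)] with x h1 h2
  rw [h1, h2]

variable {G₁ : Type*} [Group G₁] [TopologicalSpace G₁] [IsTopologicalGroup G₁]
  [LocallyCompactSpace G₁]
  {G₂ : Type*} [Group G₂] [TopologicalSpace G₂] [IsTopologicalGroup G₂]
  [LocallyCompactSpace G₂]
  (ω₁ : Weight G₁) (ω₂ : Weight G₂) {κ : ℝ≥0}

theorem convCc_tensorCc (hκ : IsHaarRatio (ContinuousMulEquiv.refl (G₁ × G₂)) κ)
    (φ φ' : C_c(G₁, ℂ)) (ψ ψ' : C_c(G₂, ℂ)) :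
    convCc (tensorCc φ ψ) (tensorCc φ' ψ') =
      (κ : ℂ) • tensorCc (convCc φ φ') (convCc ψ ψ') := by
  ext ⟨x, y⟩
  have h := hκ.integral_mul (u := fun a => φ a * φ' (a⁻¹ * x)) (v := fun b => ψ b * ψ' (b⁻¹ * y))
    φ.hasCompactSupport ψ.hasCompactSupport
    (φ.continuous.mul (φ'.continuous.comp (continuous_inv.mul continuous_const))).measurable
    (ψ.continuous.mul (ψ'.continuous.comp (continuous_inv.mul continuous_const))).measurable
    (fun a ha => by simp [image_eq_zero_of_notMem_tsupport ha])
    (fun b hb => by simp [image_eq_zero_of_notMem_tsupport hb])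
  refine Eq.trans (integral_congr_ae (ae_of_all _ fun z => ?_)) h
  exact mul_mul_mul_comm _ _ _ _

/-- The factor `κ` appears because convolution on `G₁ × G₂` integrates against Haar measure of the
product group, which is `κ` times the product of the Haar measures of the factors. -/
theorem tensorL1_mul_tensorL1 (hκ : IsHaarRatio (ContinuousMulEquiv.refl (G₁ × G₂)) κ)
    (hκ0 : 0 < κ) (f f' : L1 ω₁) (g g' : L1 ω₂) :
    tensorL1 ω₁ ω₂ hκ hκ0 f g * tensorL1 ω₁ ω₂ hκ hκ0 f' g' =
      (κ : ℂ) • tensorL1 ω₁ ω₂ hκ hκ0 (f * f') (g * g') := by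
  have hc := continuous_tensorL1 ω₁ ω₂ hκ hκ0
  refine (((denseRange_ccToL1 ω₁).prodMap (denseRange_ccToL1 ω₂)).prodMap
    ((denseRange_ccToL1 ω₁).prodMap (denseRange_ccToL1 ω₂))).induction_on
    (p := fun q => tensorL1 ω₁ ω₂ hκ hκ0 q.1.1 q.1.2 * tensorL1 ω₁ ω₂ hκ hκ0 q.2.1 q.2.2 =
      (κ : ℂ) • tensorL1 ω₁ ω₂ hκ hκ0 (q.1.1 * q.2.1) (q.1.2 * q.2.2)) ((f, g), (f', g'))
    (isClosed_eq ?_ ?_) ?_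
  · exact (hc.comp continuous_fst).mul (hc.comp continuous_snd)
  · have h : Continuous fun q : (L1 ω₁ × L1 ω₂) × (L1 ω₁ × L1 ω₂) =>
        (q.1.1 * q.2.1, q.1.2 * q.2.2) := by fun_prop
    exact (hc.comp h).const_smul (κ : ℂ)
  · rintro ⟨⟨φ, ψ⟩, φ', ψ'⟩
    simp only [Prod.map_apply]
    rw [tensorL1_ccToL1, tensorL1_ccToL1, ccToL1_mul, ccToL1_mul, ccToL1_mul, tensorL1_ccToL1,
      convCc_tensorCc hκ, map_smul]

end Convolution

/-! ### Conjugation and central functions -/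

section Conjugation

variable {G : Type*} [Group G] [TopologicalSpace G] [IsTopologicalGroup G]
  [LocallyCompactSpace G] [IsFCBar G] (ω : Weight G)

theorem quasiMeasurePreserving_conj (g : G) :
    Measure.QuasiMeasurePreserving (fun x => g⁻¹ * x * g) ω.measure ω.measure := by
  have hm := measurePreserving_conj (G := G) g
  refine ⟨hm.measurable, Measure.AbsolutelyContinuous.mk fun s hs h0 => ?_⟩
  rw [Measure.map_apply hm.measurable hs]
  have h1 : ∀ᵐ x ∂(Measure.haar : Measure G), x ∉ s :=
    (ω.ae_measure (p := fun x => x ∉ s)).1 (measure_eq_zero_iff_ae_notMem.1 h0)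
  have h2 : ∀ᵐ x ∂(Measure.haar : Measure G), g⁻¹ * x * g ∉ s :=
    hm.quasiMeasurePreserving.ae (p := fun x => x ∉ s) h1
  exact measure_eq_zero_iff_ae_notMem.2
    ((ω.ae_measure (p := fun x => g⁻¹ * x * g ∉ s)).2 h2)

/-- The function `x ↦ k (g⁻¹ * x * g)`. -/
def conjCc (g : G) (k : C_c(G, ℂ)) : C_c(G, ℂ) where
  toFun x := k (g⁻¹ * x * g)
  continuous_toFun := k.continuous.comp (by fun_prop)
  hasCompactSupport' := k.hasCompactSupport.comp_homeomorph
    ((Homeomorph.mulLeft g⁻¹).trans (Homeomorph.mulRight g))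

theorem conjL_ccToL1 (g : G) (k : C_c(G, ℂ)) :
    conjL ω g (ccToL1 ω k) = ccToL1 ω (conjCc g k) := by
  refine Lp.ext ((coeFn_conjL ω g _).trans ?_)
  filter_upwards [(quasiMeasurePreserving_conj ω g).ae (coeFn_ccToL1 ω k),
    coeFn_ccToL1 ω (conjCc g k)] with x h1 h2
  rw [h1, h2]
  rfl

theorem mem_ZL1_iff (f : L1 ω) : f ∈ ZL1 ω ↔ ∀ g, conjL ω g f = f :=
  forall_congr' fun g => (conjL_eq_iff ω g f).symm

theorem mem_ZL1_iff_ae (f : L1 ω) :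
    f ∈ ZL1 ω ↔ ∀ g : G, (fun x => f (g⁻¹ * x * g)) =ᵐ[ω.measure] f :=
  forall_congr' fun _ => ω.ae_measure.symm

/-- The inclusion of `ZL¹(G, ω)` into `L¹(G, ω)`. -/
def ZL1.incl : ZL1 ω →ₗᵢ[ℂ] L1 ω where
  toLinearMap := (ZL1 ω).toSubmodule.subtype
  norm_map' _ := rfl

theorem ZL1.incl_apply (f : ZL1 ω) : ZL1.incl ω f = (f : L1 ω) := rfl

theorem ZL1.mem_range_incl (f : L1 ω) :
    f ∈ range (ZL1.incl ω) ↔ ∀ g : G, (fun x => f (g⁻¹ * x * g)) =ᵐ[ω.measure] f := by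
  rw [← mem_ZL1_iff_ae]
  exact ⟨fun ⟨a, ha⟩ => ha ▸ a.2, fun h => ⟨⟨f, h⟩, rfl⟩⟩

variable {G₁ : Type*} [Group G₁] [TopologicalSpace G₁] [IsTopologicalGroup G₁]
  [LocallyCompactSpace G₁] [IsFCBar G₁]
  {G₂ : Type*} [Group G₂] [TopologicalSpace G₂] [IsTopologicalGroup G₂]
  [LocallyCompactSpace G₂] [IsFCBar G₂]
  (ω₁ : Weight G₁) (ω₂ : Weight G₂) {κ : ℝ≥0}

/-- Conjugation by `g = (g₁, g₂)` acts on the slices of `u` by conjugating the base point with `g₁` and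
the slice with `g₂`. -/
theorem sliceL_conjL (hκ : IsHaarRatio (ContinuousMulEquiv.refl (G₁ × G₂)) κ) (hκ0 : 0 < κ)
    (g : G₁ × G₂) (u : L1 (ω₁.prod ω₂)) :
    sliceL ω₁ ω₂ (conjL (ω₁.prod ω₂) g u) =ᵐ[ω₁.measure]
      fun x => conjL ω₂ g.2 (sliceL ω₁ ω₂ u (g.1⁻¹ * x * g.1)) := by
  have hcc : ∀ k : C_c(G₁ × G₂, ℂ),
      sliceL ω₁ ω₂ (conjL (ω₁.prod ω₂) g (ccToL1 (ω₁.prod ω₂) k)) =ᵐ[ω₁.measure]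
        fun x => conjL ω₂ g.2 (sliceL ω₁ ω₂ (ccToL1 (ω₁.prod ω₂) k) (g.1⁻¹ * x * g.1)) := by
    intro k
    rw [conjL_ccToL1, sliceL_ccToL1 ω₁ ω₂ hκ hκ0, sliceL_ccToL1 ω₁ ω₂ hκ hκ0]
    filter_upwards [coeFn_sliceCc ω₁ ω₂ (conjCc g k),
      (quasiMeasurePreserving_conj ω₁ g.1).ae (coeFn_sliceCc ω₁ ω₂ k)] with x h1 h2
    rw [h1, h2, conjL_ccToL1]
    rfl
  obtain ⟨w, hw, hwu⟩ := mem_closure_iff_seq_limit.1 (denseRange_ccToL1 (ω₁.prod ω₂) u)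
  choose k hk using hw
  obtain rfl : (fun n => ccToL1 (ω₁.prod ω₂) (k n)) = w := funext hk
  have hlim1 : Tendsto (fun n => sliceL ω₁ ω₂ (ccToL1 (ω₁.prod ω₂) (k n))) atTop
      (𝓝 (sliceL ω₁ ω₂ u)) := ((sliceL ω₁ ω₂).continuous.tendsto u).comp hwu
  have hlim2 : Tendsto
      (fun n => sliceL ω₁ ω₂ (conjL (ω₁.prod ω₂) g (ccToL1 (ω₁.prod ω₂) (k n)))) atTop
      (𝓝 (sliceL ω₁ ω₂ (conjL (ω₁.prod ω₂) g u))) :=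
    (((sliceL ω₁ ω₂).comp (conjL (ω₁.prod ω₂) g)).continuous.tendsto u).comp hwu
  -- a common subsequence along which both sequences converge almost everywhere
  obtain ⟨a, ha, ha'⟩ := (tendstoInMeasure_of_tendsto_Lp hlim1).exists_seq_tendsto_ae
  obtain ⟨b, hb, hb'⟩ := (tendstoInMeasure_of_tendsto_Lp
    (hlim2.comp ha.tendsto_atTop)).exists_seq_tendsto_ae
  filter_upwards [(quasiMeasurePreserving_conj ω₁ g.1).ae ha', hb',
    ae_all_iff.2 fun n => hcc (k n)] with x h1 h2 h3
  refine tendsto_nhds_unique h2 ?_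
  refine Tendsto.congr (fun n => (h3 _).symm) ?_
  exact ((conjL ω₂ g.2).continuous.tendsto _).comp (h1.comp hb.tendsto_atTop)

theorem isClosed_ZL1 : IsClosed (ZL1 ω : Set (L1 ω)) :=
  (completeSpace_coe_iff_isComplete.1 (inferInstanceAs (CompleteSpace (ZL1 ω)))).isClosed

/-- The slices of a central function are central. For a single `g` the slices are fixed by `conjL ω₂ g`
off a null set that depends on `g`; passing to the integrals over measurable sets, which are fixed by all
`g` at once, avoids taking the union of these null sets. -/
theorem sliceL_mem_ZL1 (hκ : IsHaarRatio (ContinuousMulEquiv.refl (G₁ × G₂)) κ) (hκ0 : 0 < κ)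
    {u : L1 (ω₁.prod ω₂)} (hu : u ∈ ZL1 (ω₁.prod ω₂)) :
    ∀ᵐ x ∂ω₁.measure, sliceL ω₁ ω₂ u x ∈ (ZL1 ω₂).toSubmodule := by
  refine ae_mem_of_forall_setIntegral_mem (isClosed_ZL1 ω₂) (L1.integrable_coeFn _) fun s _ => ?_
  refine (mem_ZL1_iff ω₂ _).2 fun g => ?_
  have hint : IntegrableOn (sliceL ω₁ ω₂ u) s ω₁.measure :=
    (L1.integrable_coeFn (sliceL ω₁ ω₂ u)).integrableOn
  refine ((conjL ω₂ g).integral_comp_comm hint).symm.trans ?_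
  refine integral_congr_ae (ae_restrict_of_ae ?_)
  have h := sliceL_conjL ω₁ ω₂ hκ hκ0 (1, g) u
  rw [(mem_ZL1_iff _ u).1 hu] at h
  filter_upwards [h] with x hx
  simpa using hx.symm

theorem tensorL1_mem_ZL1 (hκ : IsHaarRatio (ContinuousMulEquiv.refl (G₁ × G₂)) κ) (hκ0 : 0 < κ)
    {f : L1 ω₁} {h : L1 ω₂} (hf : f ∈ ZL1 ω₁) (hh : h ∈ ZL1 ω₂) :
    tensorL1 ω₁ ω₂ hκ hκ0 f h ∈ ZL1 (ω₁.prod ω₂) := by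
  refine (mem_ZL1_iff _ _).2 fun g => (sliceL_bijective ω₁ ω₂ hκ hκ0).injective (Lp.ext ?_)
  refine (sliceL_conjL ω₁ ω₂ hκ hκ0 g _).trans ?_
  rw [tensorL1_apply, sliceL_sliceEquiv_symm]
  have h1 := coeFn_smulLp f h
  filter_upwards [h1, (quasiMeasurePreserving_conj ω₁ g.1).ae h1, (mem_ZL1_iff_ae ω₁ f).1 hf g.1]
    with x h1 h2 h3
  rw [h2, h1, map_smul, (mem_ZL1_iff ω₂ h).1 hh, h3]

end Conjugation

/-! ### The tensor product of central Beurling algebras -/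

section CentralTensor

variable {G₁ : Type*} [Group G₁] [TopologicalSpace G₁] [IsTopologicalGroup G₁]
  [LocallyCompactSpace G₁] [IsFCBar G₁]
  {G₂ : Type*} [Group G₂] [TopologicalSpace G₂] [IsTopologicalGroup G₂]
  [LocallyCompactSpace G₂] [IsFCBar G₂]
  (ω₁ : Weight G₁) (ω₂ : Weight G₂) {κ : ℝ≥0}

/-- The bilinear map `(f, h) ↦ κ⁻¹ f ⊗ h` from `ZL¹(G₁, ω₁) × ZL¹(G₂, ω₂)` to `ZL¹(G₁ × G₂, ω₁ × ω₂)`.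
The factor `κ⁻¹` makes it multiplicative. -/
def centralTensor (hκ : IsHaarRatio (ContinuousMulEquiv.refl (G₁ × G₂)) κ) (hκ0 : 0 < κ) :
    ZL1 ω₁ →ₗ[ℂ] ZL1 ω₂ →ₗ[ℂ] ZL1 (ω₁.prod ω₂) :=
  LinearMap.mk₂ ℂ
    (fun f h => (κ : ℂ)⁻¹ • ⟨tensorL1 ω₁ ω₂ hκ hκ0 f h, tensorL1_mem_ZL1 ω₁ ω₂ hκ hκ0 f.2 h.2⟩)
    (fun f f' h => Subtype.ext (by simp [smul_add]))
    (fun c f h => Subtype.ext (by simp [smul_comm c]))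
    (fun f h h' => Subtype.ext (by simp [smul_add]))
    (fun c f h => Subtype.ext (by simp [smul_comm c]))

theorem coe_centralTensor (hκ : IsHaarRatio (ContinuousMulEquiv.refl (G₁ × G₂)) κ) (hκ0 : 0 < κ)
    (f : ZL1 ω₁) (h : ZL1 ω₂) : (centralTensor ω₁ ω₂ hκ hκ0 f h : L1 (ω₁.prod ω₂)) =
      (κ : ℂ)⁻¹ • tensorL1 ω₁ ω₂ hκ hκ0 f h := rfl

theorem centralTensor_mul (hκ : IsHaarRatio (ContinuousMulEquiv.refl (G₁ × G₂)) κ) (hκ0 : 0 < κ)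
    (f f' : ZL1 ω₁) (h h' : ZL1 ω₂) :
    centralTensor ω₁ ω₂ hκ hκ0 f h * centralTensor ω₁ ω₂ hκ hκ0 f' h' =
      centralTensor ω₁ ω₂ hκ hκ0 (f * f') (h * h') := by
  have hne : (κ : ℂ) ≠ 0 := by exact_mod_cast hκ0.ne'
  refine Subtype.ext ?_
  rw [NonUnitalSubalgebra.coe_mul, coe_centralTensor, coe_centralTensor, coe_centralTensor,
    smul_mul_smul_comm, tensorL1_mul_tensorL1, smul_smul, mul_assoc, inv_mul_cancel₀ hne, mul_one]
  rfl

/-- The map `f ⊗ h ↦ κ⁻¹ f ⊗ h` from the algebraic tensor product of the central Beurling algebras to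
the central Beurling algebra of the product. -/
def centralLift (hκ : IsHaarRatio (ContinuousMulEquiv.refl (G₁ × G₂)) κ) (hκ0 : 0 < κ) :
    AlgTensor (ZL1 ω₁) (ZL1 ω₂) →ₗ[ℂ] ZL1 (ω₁.prod ω₂) :=
  AlgTensor.lift (centralTensor ω₁ ω₂ hκ hκ0)

theorem centralLift_mk (hκ : IsHaarRatio (ContinuousMulEquiv.refl (G₁ × G₂)) κ) (hκ0 : 0 < κ)
    (f : ZL1 ω₁) (h : ZL1 ω₂) :
    centralLift ω₁ ω₂ hκ hκ0 (AlgTensor.mk f h) = centralTensor ω₁ ω₂ hκ hκ0 f h :=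
  AlgTensor.lift_mk _ f h

theorem AlgTensor.mk_mul_mk (f f' : ZL1 ω₁) (h h' : ZL1 ω₂) :
    (AlgTensor.mk f h * AlgTensor.mk f' h' : AlgTensor (ZL1 ω₁) (ZL1 ω₂)) =
      AlgTensor.mk (f * f') (h * h') :=
  Algebra.TensorProduct.tmul_mul_tmul f f' h h'

theorem centralLift_mul (hκ : IsHaarRatio (ContinuousMulEquiv.refl (G₁ × G₂)) κ) (hκ0 : 0 < κ)
    (s t : AlgTensor (ZL1 ω₁) (ZL1 ω₂)) :
    centralLift ω₁ ω₂ hκ hκ0 (s * t) =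
      centralLift ω₁ ω₂ hκ hκ0 s * centralLift ω₁ ω₂ hκ hκ0 t := by
  obtain ⟨m, a, b, rfl⟩ := s.exists_sum
  obtain ⟨n, a', b', rfl⟩ := t.exists_sum
  have h : (∑ i, AlgTensor.mk (a i) (b i)) * ∑ k, AlgTensor.mk (a' k) (b' k) =
      ∑ i, ∑ k, AlgTensor.mk (a i) (b i) * AlgTensor.mk (a' k) (b' k) :=
    Finset.sum_mul_sum (R := AlgTensor (ZL1 ω₁) (ZL1 ω₂)) _ _ _ _
  rw [h]
  simp only [map_sum (centralLift ω₁ ω₂ hκ hκ0), AlgTensor.mk_mul_mk,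
    centralLift_mk, ← centralTensor_mul]
  exact (Finset.sum_mul_sum (R := ZL1 (ω₁.prod ω₂)) _ _ _ _).symm

/-- In terms of slices, `centralLift` is the map `A ⊗ E → L¹(ν; E)`. -/
theorem coe_centralLift (hκ : IsHaarRatio (ContinuousMulEquiv.refl (G₁ × G₂)) κ) (hκ0 : 0 < κ)
    (t : AlgTensor (ZL1 ω₁) (ZL1 ω₂)) :
    (centralLift ω₁ ω₂ hκ hκ0 t : L1 (ω₁.prod ω₂)) = (κ : ℂ)⁻¹ • (sliceEquiv ω₁ ω₂ hκ hκ0).symm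
      ((ZL1.incl ω₂).toContinuousLinearMap.compLpL 1 ω₁.measure
        (tensorToLp (ZL1.incl ω₁) t)) := by
  obtain ⟨n, a, b, rfl⟩ := t.exists_sum
  rw [map_sum, map_sum, map_sum, map_sum, Finset.smul_sum]
  rw [← ZL1.incl_apply, map_sum]
  refine Finset.sum_congr rfl fun i _ => ?_
  rw [centralLift_mk, tensorToLp_mk, ZL1.incl_apply, coe_centralTensor, tensorL1_apply]
  congr 2
  refine Lp.ext ?_
  filter_upwards [coeFn_smulLp (ZL1.incl ω₁ (a i)) (b i),
    coeFn_smulLp (ZL1.incl ω₁ (a i)) (b i : L1 ω₂),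
    (ZL1.incl ω₂).toContinuousLinearMap.coeFn_compLpL (p := 1)
      (smulLp (ZL1.incl ω₁ (a i)) (b i))] with x h1 h2 h3
  rw [h3, h1]
  exact h2

theorem norm_centralLift (hκ : IsHaarRatio (ContinuousMulEquiv.refl (G₁ × G₂)) κ) (hκ0 : 0 < κ)
    (t : AlgTensor (ZL1 ω₁) (ZL1 ω₂)) : ‖centralLift ω₁ ω₂ hκ hκ0 t‖ = ‖t‖ := by
  rw [← (ZL1.incl (ω₁.prod ω₂)).norm_map, ZL1.incl_apply, coe_centralLift, norm_smul,
    norm_sliceEquiv_symm, norm_compLpL_isometry,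
    norm_tensorToLp (ZL1.mem_range_incl ω₁) (quasiMeasurePreserving_conj ω₁)]
  simp [hκ0.ne']

/-- The slice function of a central function takes values in `ZL¹(G₂, ω₂)` and is invariant under
conjugation, so `exists_tensorToLp_approx` applies to it. -/
theorem denseRange_centralLift (hκ : IsHaarRatio (ContinuousMulEquiv.refl (G₁ × G₂)) κ)
    (hκ0 : 0 < κ) : DenseRange (centralLift ω₁ ω₂ hκ hκ0) := by
  have hne : (κ : ℂ) ≠ 0 := by exact_mod_cast hκ0.ne'
  have hpos : (0 : ℝ) < κ := hκ0
  intro u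
  obtain ⟨F, hF⟩ := exists_compLp_eq (ZL1.incl ω₂) (sliceL ω₁ ω₂ u) (by
    filter_upwards [sliceL_mem_ZL1 ω₁ ω₂ hκ hκ0 u.2] with x hx
    exact ⟨⟨_, hx⟩, rfl⟩)
  have hcoe := (ZL1.incl ω₂).toContinuousLinearMap.coeFn_compLp F
  rw [hF] at hcoe
  have hinv : ∀ g : G₁, (fun x => F (g⁻¹ * x * g)) =ᵐ[ω₁.measure] F := fun g => by
    have h := sliceL_conjL ω₁ ω₂ hκ hκ0 (g, 1) u
    rw [(mem_ZL1_iff _ _).1 u.2] at h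
    filter_upwards [h, hcoe, (quasiMeasurePreserving_conj ω₁ g).ae hcoe] with x h1 h2 h3
    refine (ZL1.incl ω₂).injective ?_
    have h4 : conjL ω₂ 1 (sliceL ω₁ ω₂ u (g⁻¹ * x * g)) = sliceL ω₁ ω₂ u (g⁻¹ * x * g) := by
      rw [h3]
      exact (mem_ZL1_iff _ _).1 (F (g⁻¹ * x * g)).2 1
    exact h3.symm.trans (h4.symm.trans (h1.symm.trans h2))
  refine Metric.mem_closure_iff.2 fun ε hε => ?_
  obtain ⟨t, ht⟩ := exists_tensorToLp_approx (fun f => (ZL1.mem_range_incl ω₁ f).2)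
    (quasiMeasurePreserving_conj ω₁) F hinv (ε := ε / (2 * κ)) (by positivity)
  refine ⟨_, ⟨(κ : ℂ) • t, rfl⟩, ?_⟩
  have hu : (u : L1 (ω₁.prod ω₂)) = (sliceEquiv ω₁ ω₂ hκ hκ0).symm
      ((ZL1.incl ω₂).toContinuousLinearMap.compLpL 1 ω₁.measure F) := by
    rw [LinearEquiv.eq_symm_apply]
    exact hF.symm
  rw [dist_comm, dist_eq_norm, ← (ZL1.incl (ω₁.prod ω₂)).norm_map, map_sub, ZL1.incl_apply,
    ZL1.incl_apply, map_smul, NonUnitalSubalgebra.coe_smul, coe_centralLift, smul_smul,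
    mul_inv_cancel₀ hne, one_smul, hu, ← map_sub, ← map_sub, norm_sliceEquiv_symm,
    norm_compLpL_isometry]
  calc (κ : ℝ) * _ ≤ κ * (ε / (2 * κ)) := by gcongr
    _ = ε / 2 := by field_simp
    _ < ε := half_lt_self hε

end CentralTensor

end Beurling

end

theorem proposition2p2
    {G₁ : Type*} [Group G₁] [TopologicalSpace G₁] [IsTopologicalGroup G₁]
    [LocallyCompactSpace G₁] [T2Space G₁] [Beurling.IsFCBar G₁]
    {G₂ : Type*} [Group G₂] [TopologicalSpace G₂] [IsTopologicalGroup G₂]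
    [LocallyCompactSpace G₂] [T2Space G₂] [Beurling.IsFCBar G₂]
    (ω₁ : Beurling.Weight G₁) (ω₂ : Beurling.Weight G₂) (c : ℝ) (hc : 0 < c)
    (h₁ : ∀ g x : G₁, ω₁ (g * x * g⁻¹) ≤ c * ω₁ x)
    (h₂ : ∀ g x : G₂, ω₂ (g * x * g⁻¹) ≤ c * ω₂ x) :
    ∃ Φ : Beurling.ZL1 (ω₁.prod ω₂) ≃L[ℂ]
        Beurling.ProjTensor (Beurling.ZL1 ω₁) (Beurling.ZL1 ω₂),
      ∀ f g : Beurling.ZL1 (ω₁.prod ω₂), Φ (f * g) = Φ f * Φ g := by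
  obtain ⟨κ, hκ0, hκ⟩ := Beurling.exists_isHaarRatio (ContinuousMulEquiv.refl (G₁ × G₂))
  obtain ⟨Ψ, hΨ⟩ := Beurling.ProjTensor.exists_linearIsometryEquiv
    (Beurling.centralLift ω₁ ω₂ hκ hκ0) (Beurling.norm_centralLift ω₁ ω₂ hκ hκ0)
    (Beurling.denseRange_centralLift ω₁ ω₂ hκ hκ0)
  have hmul : ∀ x y, Ψ (x * y) = Ψ x * Ψ y := by
    refine Beurling.ProjTensor.induction₂ (isClosed_eq (by fun_prop) (by fun_prop)) fun s t => ?_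
    rw [← Beurling.ProjTensor.of_mul, hΨ, hΨ, hΨ, Beurling.centralLift_mul]
  refine ⟨Ψ.symm.toContinuousLinearEquiv, fun f g => Ψ.injective ?_⟩
  show Ψ (Ψ.symm (f * g)) = Ψ (Ψ.symm f * Ψ.symm g)
  rw [hmul, Ψ.apply_symm_apply, Ψ.apply_symm_apply, Ψ.apply_symm_apply]
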